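/- **Setting.** For a finite multiset $S\subset\mathbb R^d$ and a finite set $T$, let $\rho(x,T)=\min_{y\in T}\|x-y\|$ ($=\infty$ if $T=\emptyset$) and $\mathsf{cost}(S,T)=\sum_{x\in S}\rho(x,T)^2$; let $\mathsf{cost}_l(S,T)$ be this sum after removing the $\lfloor l\rfloor$ points of $S$ that incur the most cost. Let $\mathrm{OPT}_{S,k}$ minimise $\mathsf{cost}(S,T)$ over $T\subseteq S$ with $|T|\le k$. A $\beta$-approximation $k$-means algorithm is a map $\mathcal A$ with $\mathcal A(S,k)\subseteq S$, $|\mathcal A(S,k)|\le k$ and $\mathsf{cost}(S,\mathcal A(S,k))\le\beta\,\mathsf{cost}(S,\mathrm{OPT}_{S,k})$ for all $S,k$. For $\delta,\epsilon\in(0,1)$ put $L=\log\frac{1.1k}{\delta\epsilon}$, $\eta=36kn^{\epsilon}L$, $k_+=\lfloor k+9L\rfloor$, $d_k=6.5L$. The algorithm SOCCER runs on a dataset $X$ of $n$ points that is arbitrarily partitioned into parts $X_1,\dots,X_m$ held by $m$ machines. Start with $C_{\rm out}=\emptyset$ and $N=n$. While $N>\eta$, it performs a round: put $\alpha=\eta/N$;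 every remaining point is put into $P_1$ with probability $\alpha$, and into $P_2$ with probability $\alpha$, all choices being independent; $C_{\rm iter}=\mathcal A(P_1,k_+)$; $v=2\,\mathsf{cost}_{\frac32(k+1)d_k}(P_2,C_{\rm iter})/(3kd_k)$; $C_{\rm iter}$ is added to $C_{\rm out}$; every machine keeps only those of its points $x$ with $\rho(x,C_{\rm iter})^2>v$; $N$ becomes the number of points that are left. When $N\le\eta$, the algorithm outputs $C_{\rm out}\cup\mathcal A(V,k)$, where $V$ is the set of the remaining points. **Theorem.** For every $\beta\ge1$ there is a constant $C>0$ such that for every $k$ and all weights $w_1,\dots,w_k>0$ with $\sum_i w_i=1$ there are a number $n_0$ and a function $d_0:\mathbb N\to\mathbb N$ with the following property. Let $\delta,\epsilon\in(0,1)$, $n\ge n_0$, $d\ge d_0(k_+)$ and $$\epsilon\ \ge\ \frac{\log\log(n/\delta)}{\log n}.$$ Let $X$ consist of $n$ independent points drawn from a spherical Gaussian mixture $\sum_{i=1}^k w_i\,N(\mu_i,\sigma_i^2 I_d)$ with arbitrary $\mu_i\in\mathbb R^d$ and $\sigma_i>0$, arbitrarily partitioned among the machines, and let $\mathcal A$ be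 a $\beta$-approximation $k$-means algorithm. Then, with probability at least $1-\delta$ over the draw of $X$ and the sampling of the algorithm, SOCCER stops after at most one round (exactly one round if $n>\eta$, and otherwise its loop is not entered), and its output satisfies $$\mathsf{cost}(X,C_{\rm out})\ \le\ C\cdot\mathsf{cost}(X,\mathrm{OPT}_{X,k}).$$ -/

import Mathlib

open MeasureTheory ProbabilityTheory
open scoped ENNReal

noncomputable section

namespace Soccer

/-! ### `k`-means costs

Data sets are multisets of points (they may contain duplicates), sets of centers are finite sets.
Costs take values in `[0, ∞]`, with the convention that the distance to the empty set is `∞`. -/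

section Cost

variable {E : Type*} [MetricSpace E]

/-- The `k`-means cost `∑_{x ∈ S} ρ(x, T)²`, where `ρ(x, T) = min_{y ∈ T} ρ(x, y)`. -/
def cost (S : Multiset E) (T : Finset E) : ℝ≥0∞ :=
  (S.map fun x => Metric.infEDist x (T : Set E) ^ 2).sum

/-- The cost of an optimal clustering of `S` by at most `k` centers, all of which are points
of `S`. -/
def optCost (S : Multiset E) (k : ℕ) : ℝ≥0∞ :=
  ⨅ T : Finset E, ⨅ _ : (∀ y ∈ T, y ∈ S) ∧ T.card ≤ k, cost S T

/-- The `l`-truncated cost: the cost of `T` on `S` after removing the `l` points of `S` that incur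
the most cost, i.e. the least cost that is left after removing at most `l` points of `S`. -/
def truncCost (l : ℕ) (S : Multiset E) (T : Finset E) : ℝ≥0∞ :=
  ⨅ R : Multiset E, ⨅ _ : R ≤ S ∧ S.card ≤ R.card + l, cost R T

/-- `A` is a `β`-approximation `k`-means algorithm: for every input data set `S` and every number
`k` of centers, `A S k` is a set of at most `k` points of `S` whose cost is at most `β` times that
of an optimal set of at most `k` centers from `S`. -/
structure IsApproxAlgorithm (β : ℝ) (A : Multiset E → ℕ → Finset E) : Prop where
  subset : ∀ S k, ∀ y ∈ A S k, y ∈ S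
  card_le : ∀ S k, (A S k).card ≤ k
  cost_le : ∀ S k, cost S (A S k) ≤ ENNReal.ofReal β * optCost S k

end Cost

/-! ### The parameters of the algorithm -/

/-- The coordinator size `η(ε) = 36 k n^ε log (1.1 k / (δ ε))`. -/
def eta (δ ε : ℝ) (k n : ℕ) : ℝ :=
  36 * k * (n : ℝ) ^ ε * Real.log (1.1 * k / (δ * ε))

/-- `k₊ = k + 9 log (1.1 k / (δ ε))`, rounded down: at most `k₊` centers is the same as at most
`⌊k₊⌋` centers. -/
def kPlus (δ ε : ℝ) (k : ℕ) : ℕ :=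
  ⌊(k : ℝ) + 9 * Real.log (1.1 * k / (δ * ε))⌋₊

/-- `d_k = 6.5 log (1.1 k / (δ ε))`. -/
def dK (δ ε : ℝ) (k : ℕ) : ℝ :=
  6.5 * Real.log (1.1 * k / (δ * ε))

/-- The number `(3/2) (k + 1) d_k` of points removed in the truncated cost, rounded down. -/
def truncNum (δ ε : ℝ) (k : ℕ) : ℕ :=
  ⌊3 / 2 * ((k : ℝ) + 1) * dK δ ε k⌋₊

/-! ### The algorithm -/

/-- The random numbers used by a run on `n` data points: for each round `t`, each of the two
sub-samples `l` and each data point `i`, a number in `[0, 1]`. In round `t`, point `i` joins the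
sub-sample `l` if its number is at most the current sampling probability. -/
abbrev Coins (n : ℕ) : Type := ℕ × Fin 2 × Fin n → unitInterval

/-- The input of a run: `n` data points, each held by one of `m` machines, the confidence
parameter `δ`, the coordinator parameter `ε`, the number `k` of centers and the black-box
algorithm `A`. -/
structure Input (E : Type*) (n m : ℕ) where
  x : Fin n → E
  machine : Fin n → Fin m
  δ : ℝ
  ε : ℝ
  k : ℕ
  A : Multiset E → ℕ → Finset E

namespace Input

variable {E : Type*} [MetricSpace E] {n m : ℕ} (I : Input E n m)

/-- The (multi)set of points with indices in `s`. -/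
def points (s : Finset (Fin n)) : Multiset E := s.val.map I.x

/-- The number of remaining data points, when machine `j` holds the points in `X j`. -/
def total (X : Fin m → Finset (Fin n)) : ℕ := ∑ j, (X j).card

/-- The sampling probability `α = η(ε) / N`. -/
def alpha (X : Fin m → Finset (Fin n)) : ℝ := eta I.δ I.ε I.k n / (total X : ℝ)

/-- The sub-sample `P_j^l` of machine `j` in round `t`. -/
def machineSample (c : Coins n) (t : ℕ) (X : Fin m → Finset (Fin n)) (l : Fin 2) (j : Fin m) :
    Finset (Fin n) :=
  (X j).filter fun i => (c (t, l, i) : ℝ) ≤ I.alpha X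

/-- The sub-sample `P_l` that the coordinator holds in round `t`. -/
def sample (c : Coins n) (t : ℕ) (X : Fin m → Finset (Fin n)) (l : Fin 2) : Finset (Fin n) :=
  Finset.univ.biUnion (I.machineSample c t X l)

/-- The centers `C_iter = A(P₁, k₊)` computed in round `t`. -/
def iterCenters (c : Coins n) (t : ℕ) (X : Fin m → Finset (Fin n)) : Finset E :=
  I.A (I.points (I.sample c t X 0)) (kPlus I.δ I.ε I.k)

/-- The threshold `v = 2 cost_{(3/2)(k+1)d_k}(P₂, C_iter) / (3 k d_k)` computed in round `t`. -/
def threshold (c : Coins n) (t : ℕ) (X : Fin m → Finset (Fin n)) : ℝ≥0∞ :=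
  2 * truncCost (truncNum I.δ I.ε I.k) (I.points (I.sample c t X 1)) (I.iterCenters c t X) /
    ENNReal.ofReal (3 * I.k * dK I.δ I.ε I.k)

/-- The removal step of round `t`: each machine keeps its points `x` with `ρ(x, C_iter)² > v`. -/
def remove (c : Coins n) (t : ℕ) (X : Fin m → Finset (Fin n)) : Fin m → Finset (Fin n) :=
  open scoped Classical in
  fun j => (X j).filter fun i =>
    I.threshold c t X < Metric.infEDist (I.x i) (I.iterCenters c t X : Set E) ^ 2

/-- The points held by the machines after `t` rounds of the main loop. -/
def data (c : Coins n) : ℕ → Fin m → Finset (Fin n)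
  | 0 => fun j => Finset.univ.filter fun i => I.machine i = j
  | t + 1 => I.remove c t (data c t)

/-- The main loop `while N > η(ε)` ends after exactly `r` rounds. -/
def StopsAfter (c : Coins n) (r : ℕ) : Prop :=
  (∀ t < r, eta I.δ I.ε I.k n < (total (I.data c t) : ℝ)) ∧
    (total (I.data c r) : ℝ) ≤ eta I.δ I.ε I.k n

/-- The output `C_out` of a run whose main loop ends after `r` rounds: the centers found in these
rounds, together with the clustering `A(V, k)` of the set `V` of the remaining points. -/
def output (c : Coins n) (r : ℕ) : Finset E :=
  open scoped Classical in
  ((Finset.range r).biUnion fun t => I.iterCenters c t (I.data c t)) ∪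
    I.A (I.points (Finset.univ.biUnion (I.data c r))) I.k

end Input

/-! ### The random data -/

/-- The mixture `∑ i, w i • N(μ i, (σ i)² I)` of `k` spherical Gaussians in `ℝ^d`. -/
def sphericalMixture {d k : ℕ} (w : Fin k → ℝ) (μ : Fin k → EuclideanSpace ℝ (Fin d))
    (σ : Fin k → ℝ) : Measure (EuclideanSpace ℝ (Fin d)) :=
  ∑ i, ENNReal.ofReal (w i) •
    multivariateGaussian (μ i) (σ i ^ 2 • (1 : Matrix (Fin d) (Fin d) ℝ))

/-- The joint law of `n` independent data points drawn from `ν` and of the independent random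
numbers, uniform in `[0, 1]`, that the algorithm uses. -/
def jointLaw {E : Type*} [MeasurableSpace E] (ν : Measure E) (n : ℕ) :
    Measure ((Fin n → E) × Coins n) :=
  (Measure.pi fun _ : Fin n => ν).prod
    (Measure.infinitePi fun _ : ℕ × Fin 2 × Fin n => (volume : Measure unitInterval))

end Soccer

end

noncomputable section

/-! In high dimension a point drawn from component `i` lies at distance of order `r i = σ i * √d`
from `μ i`, while any fixed point is within `r i / 2` of it with probability at most `exp (-d/6)`.
So a data point is hardly better as a center for the other points than nothing nearby at all: every
component contributes about `w i * r i ^ 2` per data point to the cost, however the mixture is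
arranged. All costs are compared with `Φ = ∑ i, w i * r i ^ 2`.

Each point carries the hidden label of its component. Two properties of a labelled sample suffice.
It is typical if each component has about the right number of points, a bounded second moment at
scale `r i`, and a fixed share of points within `3 * r i` of `μ i`. It is separated if no choice of
few data points as centers comes close to many of the others. Typicality comes from Chernoff bounds
(`pi_not_isTypical_le`). Separation comes from freezing the chosen centers, applying Chernoff to the
rest, and a union bound over all choices (`pi_not_isSeparated_le`). The union makes it irrelevant
how the black box picks its centers, so it need not even be measurable.

Cost: the optimum on the whole data is at least `n * Φ / 64` by separation
(`IsSeparated.le_optCost`). On `P₁`, one typical point per component costs at most `70 * |P₁| * Φ`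
(`IsTypical.optCost_le`), so the centers computed from `P₁` have weighted squared distance `O(β Φ)`
from the means (`IsTypical.sum_infDist_sq_le`), hence cost `O(β n Φ)` on the whole data
(`IsTypical.sum_infDist_sq_le_add`).

Stopping: by separation of `P₂` from `P₁`, the truncated cost on `P₂` is at least of order `w i *
|P₂|` times both `r i ^ 2` and the squared excess distance of `μ i` from the centers
(`IsSeparated.infDist_sq_le_truncCost`). All points satisfy `dist² ≤ 8 (1 + log (n/δ) / d) r²`. The
condition on `ε` says `n ^ ε ≥ log (n/δ)`, so `|P₂|` is large enough for the threshold to exceed the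
squared distance of every point. Nothing remains after one round, and the last call of the black box
adds no center. -/

namespace Soccer

/-! ### Exponential tail bounds -/

/-- Chernoff's bound for a sum of independent random variables. -/
theorem measure_le_sum_le_exp {Ω ι : Type*} [MeasurableSpace Ω] {P : Measure Ω}
    {f : ι → Ω → ℝ} (hind : iIndepFun f P) (hm : ∀ i, Measurable (f i)) (S : Finset ι) {b : ℝ}
    (hb : ∀ i ∈ S, ∫⁻ ω, ENNReal.ofReal (Real.exp (f i ω)) ∂P ≤ ENNReal.ofReal (Real.exp b))
    (t : ℝ) :
    P {ω | t ≤ ∑ i ∈ S, f i ω} ≤ ENNReal.ofReal (Real.exp (S.card * b - t)) := by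
  have hmg : ∀ i, Measurable fun ω => ENNReal.ofReal (Real.exp (f i ω)) := fun i =>
    (Real.measurable_exp.comp (hm i)).ennreal_ofReal
  have hindg : iIndepFun (fun i ω => ENNReal.ofReal (Real.exp (f i ω))) P :=
    hind.comp (fun _ x => ENNReal.ofReal (Real.exp x))
      (fun _ => Real.measurable_exp.ennreal_ofReal)
  have hprod : ∫⁻ ω, ∏ i ∈ S, ENNReal.ofReal (Real.exp (f i ω)) ∂P ≤
      ENNReal.ofReal (Real.exp (S.card * b)) := by
    rw [lintegral_prod_eq_prod_lintegral_of_indepFun S _ hindg hmg]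
    refine (Finset.prod_le_prod' hb).trans ?_
    rw [Finset.prod_const, ← ENNReal.ofReal_pow (Real.exp_nonneg _), ← Real.exp_nat_mul]
  have hsub : {ω | t ≤ ∑ i ∈ S, f i ω} ⊆
      {ω | ENNReal.ofReal (Real.exp t) ≤ ∏ i ∈ S, ENNReal.ofReal (Real.exp (f i ω))} := by
    intro ω hω
    simp only [Set.mem_ofPred_eq] at hω ⊢
    rw [← ENNReal.ofReal_prod_of_nonneg fun i _ => Real.exp_nonneg _, ← Real.exp_sum]
    exact ENNReal.ofReal_le_ofReal (Real.exp_le_exp.2 hω)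
  refine (measure_mono hsub).trans ?_
  refine (meas_ge_le_lintegral_div (Finset.aemeasurable_fun_prod S fun i _ => (hmg i).aemeasurable)
    (by simp [Real.exp_pos]) ENNReal.ofReal_ne_top).trans ?_
  rw [Real.exp_sub, ENNReal.ofReal_div_of_pos (Real.exp_pos _)]
  exact ENNReal.div_le_div_right hprod _

/-- Chernoff's bound for independent samples from a common law. -/
theorem pi_le_sum_le_exp {Ω ι : Type*} [Fintype ι] [MeasurableSpace Ω] (ν : Measure Ω)
    [IsProbabilityMeasure ν] {f : Ω → ℝ} (hm : Measurable f) (S : Finset ι) {b : ℝ}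
    (hb : ∫⁻ ω, ENNReal.ofReal (Real.exp (f ω)) ∂ν ≤ ENNReal.ofReal (Real.exp b)) (t : ℝ) :
    (Measure.pi fun _ : ι => ν) {x | t ≤ ∑ i ∈ S, f (x i)} ≤
      ENNReal.ofReal (Real.exp (S.card * b - t)) := by
  refine measure_le_sum_le_exp (f := fun i (x : ι → Ω) => f (x i))
    (iIndepFun_pi (X := fun _ => f) fun _ => hm.aemeasurable)
    (fun i => hm.comp (measurable_pi_apply i)) S (fun i _ => ?_) t
  exact ((measurePreserving_eval (fun _ : ι => ν) i).lintegral_comp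
    (Real.measurable_exp.comp hm).ennreal_ofReal).trans_le hb

/-- The exponential moment of a multiple of an indicator function. -/
theorem lintegral_exp_indicator {Ω : Type*} [MeasurableSpace Ω] (ν : Measure Ω)
    [IsProbabilityMeasure ν] {A : Set Ω} (hA : MeasurableSet A) (t : ℝ) :
    ∫⁻ ω, ENNReal.ofReal (Real.exp (A.indicator (fun _ => t) ω)) ∂ν =
      ENNReal.ofReal (1 + ν.real A * (Real.exp t - 1)) := by
  have h : ∀ ω, ENNReal.ofReal (Real.exp (A.indicator (fun _ => t) ω)) =
      A.indicator (fun _ => ENNReal.ofReal (Real.exp t)) ω + Aᶜ.indicator (fun _ => 1) ω := by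
    intro ω
    by_cases hω : ω ∈ A <;> simp [hω]
  simp_rw [h]
  rw [lintegral_add_left (measurable_const.indicator hA), lintegral_indicator_const hA,
    lintegral_indicator_const hA.compl, one_mul, ← ofReal_measureReal (μ := ν) (s := A),
    ← ofReal_measureReal (μ := ν) (s := Aᶜ), measureReal_compl hA,
    ← ENNReal.ofReal_mul (Real.exp_nonneg _), ← ENNReal.ofReal_add
      (mul_nonneg (Real.exp_nonneg _) measureReal_nonneg) (by simp [measureReal_le_one])]
  congr 1
  simp
  ring

/-- A bound for the exponential moment of a multiple of an indicator function. -/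
theorem lintegral_exp_indicator_le {Ω : Type*} [MeasurableSpace Ω] (ν : Measure Ω)
    [IsProbabilityMeasure ν] {A : Set Ω} (hA : MeasurableSet A) {t p : ℝ}
    (h : ν.real A * (Real.exp t - 1) ≤ p) :
    ∫⁻ ω, ENNReal.ofReal (Real.exp (A.indicator (fun _ => t) ω)) ∂ν ≤
      ENNReal.ofReal (Real.exp p) := by
  rw [lintegral_exp_indicator ν hA]
  -- This is `1 + p ≤ exp p`, which turns a bound on a mean into an exponent for Chernoff.
  exact ENNReal.ofReal_le_ofReal (by linarith [Real.add_one_le_exp p])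

theorem measurable_piecewise_prod {Ω ι : Type*} [DecidableEq ι] [MeasurableSpace Ω]
    (J : Finset ι) : Measurable fun q : (ι → Ω) × (ι → Ω) => J.piecewise q.1 q.2 := by
  refine measurable_pi_lambda _ fun i => ?_
  by_cases hi : i ∈ J <;> simp only [Finset.piecewise, hi, if_true, if_false] <;> fun_prop

/-- Resampling the coordinates in `J` preserves a product measure. -/
theorem map_piecewise_pi {Ω ι : Type*} [Fintype ι] [DecidableEq ι] [MeasurableSpace Ω]
    (ν : Measure Ω) [IsProbabilityMeasure ν] (J : Finset ι) :
    ((Measure.pi fun _ : ι => ν).prod (Measure.pi fun _ : ι => ν)).map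
      (fun q => J.piecewise q.1 q.2) = Measure.pi fun _ : ι => ν := by
  have hmeas := measurable_piecewise_prod (Ω := Ω) J
  symm
  refine Measure.pi_eq fun s hs => ?_
  rw [Measure.map_apply hmeas (MeasurableSet.univ_pi hs)]
  have hset : (fun q : (ι → Ω) × (ι → Ω) => J.piecewise q.1 q.2) ⁻¹' Set.univ.pi s =
      (Set.univ.pi fun i => if i ∈ J then s i else Set.univ) ×ˢ
        (Set.univ.pi fun i => if i ∈ J then Set.univ else s i) := by
    ext q
    simp only [Set.mem_preimage, Set.mem_univ_pi, Set.mem_prod, Finset.piecewise]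
    rw [← forall_and]
    refine forall_congr' fun i => ?_
    by_cases hi : i ∈ J <;> simp [hi]
  rw [hset, Measure.prod_prod, Measure.pi_pi, Measure.pi_pi, ← Finset.prod_mul_distrib]
  refine Finset.prod_congr rfl fun i _ => ?_
  by_cases hi : i ∈ J <;> simp [hi]

/-- A bound for the probability of an event of a product space follows from one that holds
conditionally on the coordinates in `J`. -/
theorem pi_le_of_forall_piecewise {Ω ι : Type*} [Fintype ι] [DecidableEq ι] [MeasurableSpace Ω]
    (ν : Measure Ω) [IsProbabilityMeasure ν] (J : Finset ι) {A : Set (ι → Ω)}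
    (hA : MeasurableSet A) {b : ℝ≥0∞}
    (h : ∀ y : ι → Ω, (Measure.pi fun _ : ι => ν) {x | J.piecewise y x ∈ A} ≤ b) :
    (Measure.pi fun _ : ι => ν) A ≤ b := by
  have hmeas := measurable_piecewise_prod (Ω := Ω) J
  rw [← map_piecewise_pi ν J, Measure.map_apply hmeas hA, Measure.prod_apply (hmeas hA)]
  calc _ ≤ ∫⁻ _ : ι → Ω, b ∂(Measure.pi fun _ : ι => ν) := lintegral_mono h
    _ = b := by simp

/-! ### Estimates for spherical Gaussians -/

theorem lintegral_gaussianReal_zero_one {f : ℝ → ℝ} (hf : Measurable f) :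
    ∫⁻ x, ENNReal.ofReal (f x) ∂(gaussianReal 0 1) =
      ∫⁻ x, ENNReal.ofReal ((√(2 * Real.pi))⁻¹ * (Real.exp (-x ^ 2 / 2) * f x)) := by
  rw [gaussianReal_of_var_ne_zero _ one_ne_zero,
    lintegral_withDensity_eq_lintegral_mul _ (measurable_gaussianPDF 0 1) hf.ennreal_ofReal]
  refine lintegral_congr fun x => ?_
  rw [Pi.mul_apply, gaussianPDF, ← ENNReal.ofReal_mul (gaussianPDFReal_nonneg _ _ _),
    gaussianPDFReal]
  simp [mul_assoc]

theorem lintegral_ofReal_exp_neg_mul_sq {b : ℝ} (hb : 0 < b) (c : ℝ) {m : ℝ} (hm : 0 ≤ m) :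
    ∫⁻ x : ℝ, ENNReal.ofReal (m * Real.exp (-b * (x - c) ^ 2)) =
      ENNReal.ofReal (m * √(Real.pi / b)) := by
  rw [lintegral_sub_right_eq_self (fun x : ℝ => ENNReal.ofReal (m * Real.exp (-b * x ^ 2))) c,
    ← ofReal_integral_eq_lintegral_ofReal ((integrable_exp_neg_mul_sq hb).const_mul _)
      (ae_of_all _ fun x => mul_nonneg hm (Real.exp_nonneg _)),
    integral_const_mul, integral_gaussian]

theorem lintegral_exp_mul_sq_gaussianReal {a : ℝ} (ha : a < 1 / 2) :
    ∫⁻ x, ENNReal.ofReal (Real.exp (a * x ^ 2)) ∂(gaussianReal 0 1) =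
      ENNReal.ofReal (√(1 - 2 * a))⁻¹ := by
  rw [lintegral_gaussianReal_zero_one (by fun_prop)]
  have h := lintegral_ofReal_exp_neg_mul_sq (b := 1 / 2 - a) (by linarith) 0
    (m := (√(2 * Real.pi))⁻¹) (by positivity)
  have h2 : √(Real.pi / (1 / 2 - a)) = √(2 * Real.pi) * (√(1 - 2 * a))⁻¹ := by
    rw [← Real.sqrt_inv, ← Real.sqrt_mul (by positivity)]
    congr 1
    have : 1 - 2 * a ≠ 0 := by linarith
    have : 1 / 2 - a ≠ 0 := by linarith
    field_simp
  rw [h2, inv_mul_cancel_left₀ (by positivity)] at h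
  rw [← h]
  refine lintegral_congr fun x => ?_
  rw [← Real.exp_add]
  congr 3
  ring

/-- The standard normal density never exceeds `1 / √(2π)`, and the remaining Gaussian integral does
not see the shift: it gives `√(π/2) / √(2π) = 1/2`. -/
theorem lintegral_exp_neg_two_mul_sub_sq_gaussianReal_le (c : ℝ) :
    ∫⁻ x, ENNReal.ofReal (Real.exp (-2 * (x - c) ^ 2)) ∂(gaussianReal 0 1) ≤
      ENNReal.ofReal (1 / 2) := by
  rw [lintegral_gaussianReal_zero_one (by fun_prop)]
  have h := lintegral_ofReal_exp_neg_mul_sq (b := 2) (by norm_num) c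
    (m := (√(2 * Real.pi))⁻¹) (by positivity)
  have h2 : √(Real.pi / 2) = √(2 * Real.pi) * (1 / 2) := by
    rw [show Real.pi / 2 = (2 * Real.pi) * (1 / 2) ^ 2 by ring, Real.sqrt_mul (by positivity),
      Real.sqrt_sq (by norm_num)]
  rw [h2, inv_mul_cancel_left₀ (by positivity)] at h
  rw [← h]
  refine lintegral_mono fun x => ENNReal.ofReal_le_ofReal ?_
  refine mul_le_mul_of_nonneg_left ?_ (by positivity)
  exact mul_le_of_le_one_left (Real.exp_nonneg _)
    (Real.exp_le_one_iff.2 (by nlinarith [sq_nonneg x]))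

theorem iIndepFun_coord_stdGaussian {d : ℕ} :
    iIndepFun (fun (j : Fin d) (z : Fin d → ℝ) => z j)
      (Measure.pi fun _ : Fin d => gaussianReal 0 1) :=
  iIndepFun_pi (X := fun _ => id) fun _ => aemeasurable_id

theorem lintegral_exp_mul_norm_sq_stdGaussian {d : ℕ} {a : ℝ} (ha : a < 1 / 2) :
    ∫⁻ z, ENNReal.ofReal (Real.exp (a * ‖z‖ ^ 2)) ∂(stdGaussian (EuclideanSpace ℝ (Fin d))) =
      ENNReal.ofReal ((√(1 - 2 * a))⁻¹ ^ d) := by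
  rw [← map_pi_eq_stdGaussian, lintegral_map (by fun_prop) (by fun_prop)]
  have hm : Measurable fun x : ℝ => ENNReal.ofReal (Real.exp (a * x ^ 2)) := by fun_prop
  have h := lintegral_prod_eq_prod_lintegral_of_indepFun Finset.univ
    (fun (j : Fin d) (z : Fin d → ℝ) => ENNReal.ofReal (Real.exp (a * z j ^ 2)))
    (iIndepFun_coord_stdGaussian.comp (fun _ x => ENNReal.ofReal (Real.exp (a * x ^ 2)))
      fun _ => hm) (fun j => hm.comp (measurable_pi_apply j))
  have h1 : ∀ j : Fin d, ∫⁻ z : Fin d → ℝ, ENNReal.ofReal (Real.exp (a * z j ^ 2))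
      ∂(Measure.pi fun _ : Fin d => gaussianReal 0 1) = ENNReal.ofReal (√(1 - 2 * a))⁻¹ := fun j =>
    ((measurePreserving_eval (fun _ : Fin d => gaussianReal 0 1) j).lintegral_comp hm).trans
      (lintegral_exp_mul_sq_gaussianReal ha)
  simp_rw [h1] at h
  rw [Finset.prod_const, Finset.card_univ, Fintype.card_fin,
    ← ENNReal.ofReal_pow (by positivity)] at h
  rw [← h]
  refine lintegral_congr fun z => ?_
  rw [← ENNReal.ofReal_prod_of_nonneg fun i _ => Real.exp_nonneg _, ← Real.exp_sum,
    EuclideanSpace.real_norm_sq_eq, Finset.mul_sum]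

/-- Small balls are rare wherever they are centered: Chernoff with the exponent `-2 * ‖z - c‖ ^ 2`
gains a factor `1/2` per coordinate and loses `exp (d/2)`. Since `log 2 > 2/3`, the exponent `d/2 -
d * log 2` is at most `-d/6`. -/
theorem stdGaussian_norm_sub_sq_le {d : ℕ} (c : EuclideanSpace ℝ (Fin d)) :
    stdGaussian (EuclideanSpace ℝ (Fin d)) {z | ‖z - c‖ ^ 2 ≤ d / 4} ≤
      ENNReal.ofReal (Real.exp (-(d / 6))) := by
  have hs : MeasurableSet {z : EuclideanSpace ℝ (Fin d) | ‖z - c‖ ^ 2 ≤ d / 4} :=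
    measurableSet_le (by fun_prop) (by fun_prop)
  rw [← map_pi_eq_stdGaussian, Measure.map_apply (by fun_prop) hs]
  have h := measure_le_sum_le_exp (P := Measure.pi fun _ : Fin d => gaussianReal 0 1)
    (f := fun (j : Fin d) (z : Fin d → ℝ) => -2 * (z j - c j) ^ 2)
    (iIndepFun_coord_stdGaussian.comp (fun j x => -2 * (x - c j) ^ 2) fun j => by fun_prop)
    (fun j => by fun_prop) Finset.univ (b := -Real.log 2) (fun j _ => by
      have hm : Measurable fun x : ℝ => ENNReal.ofReal (Real.exp (-2 * (x - c j) ^ 2)) := by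
        fun_prop
      refine ((measurePreserving_eval (fun _ : Fin d => gaussianReal 0 1) j).lintegral_comp
        hm).trans_le ?_
      rw [Real.exp_neg, Real.exp_log two_pos, ← one_div]
      exact lintegral_exp_neg_two_mul_sub_sq_gaussianReal_le _) (-(d / 2))
  refine (measure_mono ?_).trans (h.trans (ENNReal.ofReal_le_ofReal (Real.exp_le_exp.2 ?_)))
  · intro z hz
    simp only [Set.mem_preimage, Set.mem_ofPred_eq, EuclideanSpace.real_norm_sq_eq] at hz ⊢
    rw [← Finset.mul_sum]
    simp at hz
    linarith
  · rw [Finset.card_univ, Fintype.card_fin]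
    have := Real.log_two_gt_d9
    have hd : (0 : ℝ) ≤ d := Nat.cast_nonneg d
    nlinarith

open scoped MatrixOrder in
theorem multivariateGaussian_smul_one {d : ℕ} (μ : EuclideanSpace ℝ (Fin d)) {σ : ℝ} (hσ : 0 < σ) :
    multivariateGaussian μ (σ ^ 2 • (1 : Matrix (Fin d) (Fin d) ℝ)) =
      (stdGaussian (EuclideanSpace ℝ (Fin d))).map fun z => μ + σ • z := by
  have h : CFC.sqrt (σ ^ 2 • (1 : Matrix (Fin d) (Fin d) ℝ)) = σ • 1 := by
    refine CFC.sqrt_unique ?_ (smul_nonneg hσ.le zero_le_one)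
    rw [smul_mul_smul_comm, mul_one, sq]
  rw [multivariateGaussian, h]
  congr 1
  ext z
  simp

section Component

variable {d : ℕ} (μ : EuclideanSpace ℝ (Fin d)) {σ : ℝ}

/-- At the scale `σ * √d` the exponential moment is bounded uniformly in `d`: it equals `(1 -
1/(2d)) ^ (-d/2)`, and Bernoulli's inequality gives `(1 - 1/(2d)) ^ d ≥ 1/2`. -/
theorem lintegral_exp_dist_sq_gaussian_le (hσ : 0 < σ) (hd : 0 < d) :
    ∫⁻ x, ENNReal.ofReal (Real.exp (dist x μ ^ 2 / (4 * (σ * √d) ^ 2)))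
      ∂(multivariateGaussian μ (σ ^ 2 • (1 : Matrix (Fin d) (Fin d) ℝ))) ≤
      ENNReal.ofReal (√2) := by
  have hd' : (1 : ℝ) ≤ d := by exact_mod_cast hd
  rw [multivariateGaussian_smul_one μ hσ, lintegral_map (by fun_prop) (by fun_prop)]
  have h : ∀ z : EuclideanSpace ℝ (Fin d),
      dist (μ + σ • z) μ ^ 2 / (4 * (σ * √d) ^ 2) = 1 / (4 * d) * ‖z‖ ^ 2 := by
    intro z
    rw [dist_eq_norm, add_sub_cancel_left, norm_smul, Real.norm_of_nonneg hσ.le, mul_pow, mul_pow,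
      Real.sq_sqrt (by positivity)]
    field_simp
  simp_rw [h]
  have h4 : 1 / (4 * (d : ℝ)) ≤ 1 / 4 := by
    rw [div_le_div_iff₀ (by positivity) (by norm_num)]
    linarith
  rw [lintegral_exp_mul_norm_sq_stdGaussian (by linarith)]
  refine ENNReal.ofReal_le_ofReal ?_
  have hb := one_add_mul_le_pow (a := -(2 * (1 / (4 * (d : ℝ))))) (by linarith) d
  have hc : 1 + d * -(2 * (1 / (4 * (d : ℝ)))) = 1 / 2 := by
    field_simp
    norm_num
  rw [hc, ← sub_eq_add_neg] at hb
  have h0 : (0 : ℝ) ≤ 1 - 2 * (1 / (4 * d)) := by linarith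
  refine Real.le_sqrt_of_sq_le ?_
  rw [pow_right_comm, inv_pow, Real.sq_sqrt h0, inv_pow, inv_le_comm₀ (by linarith) two_pos]
  linarith

/-- Markov's inequality for `exp (‖z‖² / 4)`, whose mean is `√2 ^ d ≤ exp d`; the threshold `exp (2
(d + u))` leaves `exp (-d - 2u)`. Used with `u = log (n/δ)`, this survives a union bound over all
data points. -/
theorem gaussian_dist_sq_ge_le (hσ : 0 < σ) {u : ℝ} :
    multivariateGaussian μ (σ ^ 2 • (1 : Matrix (Fin d) (Fin d) ℝ))
      {x | 8 * σ ^ 2 * (d + u) < dist x μ ^ 2} ≤ ENNReal.ofReal (Real.exp (-(2 * u))) := by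
  rw [multivariateGaussian_smul_one μ hσ, Measure.map_apply (by fun_prop)
    (measurableSet_lt (by fun_prop) (by fun_prop))]
  have hsub : (fun z : EuclideanSpace ℝ (Fin d) => μ + σ • z) ⁻¹'
      {x | 8 * σ ^ 2 * (d + u) < dist x μ ^ 2} ⊆
      {z | ENNReal.ofReal (Real.exp (2 * (d + u))) ≤
        ENNReal.ofReal (Real.exp (1 / 4 * ‖z‖ ^ 2))} := by
    intro z hz
    simp only [Set.mem_preimage, Set.mem_ofPred_eq, dist_eq_norm, add_sub_cancel_left, norm_smul,
      Real.norm_of_nonneg hσ.le, mul_pow] at hz ⊢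
    refine ENNReal.ofReal_le_ofReal (Real.exp_le_exp.2 ?_)
    have : 8 * (d + u) < ‖z‖ ^ 2 :=
      lt_of_mul_lt_mul_left (a := σ ^ 2) (by linarith) (by positivity)
    linarith
  refine (measure_mono hsub).trans ((meas_ge_le_lintegral_div (by fun_prop)
    (by simp [Real.exp_pos]) ENNReal.ofReal_ne_top).trans ?_)
  rw [lintegral_exp_mul_norm_sq_stdGaussian (by norm_num),
    ← ENNReal.ofReal_div_of_pos (Real.exp_pos _)]
  refine ENNReal.ofReal_le_ofReal ?_
  rw [div_le_iff₀ (Real.exp_pos _), ← Real.exp_add]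
  have h2 : (√(1 - 2 * (1 / 4)))⁻¹ ≤ Real.exp 1 := by
    rw [inv_le_comm₀ (by norm_num) (Real.exp_pos _), ← Real.exp_neg]
    refine Real.le_sqrt_of_sq_le ?_
    rw [← Real.exp_nat_mul]
    have := Real.exp_neg_one_lt_d9
    exact (Real.exp_le_exp.2 (by norm_num)).trans (this.le.trans (by norm_num))
  refine (pow_le_pow_left₀ (by positivity) h2 d).trans ?_
  rw [← Real.exp_nat_mul]
  refine Real.exp_le_exp.2 ?_
  have : (0 : ℝ) ≤ d := Nat.cast_nonneg d
  linarith

theorem gaussian_dist_lt_le (hσ : 0 < σ) (c : EuclideanSpace ℝ (Fin d)) :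
    multivariateGaussian μ (σ ^ 2 • (1 : Matrix (Fin d) (Fin d) ℝ))
      {x | dist x c < σ * √d / 2} ≤ ENNReal.ofReal (Real.exp (-(d / 6))) := by
  rw [multivariateGaussian_smul_one μ hσ, Measure.map_apply (by fun_prop)
    (measurableSet_lt (by fun_prop) (by fun_prop))]
  refine (measure_mono ?_).trans (stdGaussian_norm_sub_sq_le (σ⁻¹ • (c - μ)))
  intro z hz
  simp only [Set.mem_preimage, Set.mem_ofPred_eq] at hz ⊢
  have h1 : dist (μ + σ • z) c = σ * ‖z - σ⁻¹ • (c - μ)‖ := by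
    rw [dist_eq_norm, ← Real.norm_of_nonneg hσ.le, ← norm_smul, Real.norm_of_nonneg hσ.le, smul_sub,
      smul_inv_smul₀ hσ.ne']
    congr 1
    abel
  rw [h1, mul_div_assoc] at hz
  have h2 := lt_of_mul_lt_mul_left hz hσ.le
  calc ‖z - σ⁻¹ • (c - μ)‖ ^ 2 ≤ (√d / 2) ^ 2 := pow_le_pow_left₀ (norm_nonneg _) h2.le 2
    _ = d / 4 := by rw [div_pow, Real.sq_sqrt (by positivity)]; norm_num

end Component

/-! ### Labelled samples from a mixture -/

section Labelled

variable {E : Type*} [MeasurableSpace E] {k : ℕ}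

/-- The law of a point of the mixture `∑ i, w i • N i` together with the label of the component it
is drawn from. -/
def labelledMixture (w : Fin k → ℝ) (N : Fin k → Measure E) : Measure (Fin k × E) :=
  ∑ i, ENNReal.ofReal (w i) • (N i).map (Prod.mk i)

variable {w : Fin k → ℝ} {N : Fin k → Measure E}

theorem lintegral_labelledMixture {h : Fin k × E → ℝ≥0∞} (hh : Measurable h) :
    ∫⁻ q, h q ∂(labelledMixture w N) = ∑ i, ENNReal.ofReal (w i) * ∫⁻ x, h (i, x) ∂(N i) := by
  simp only [labelledMixture, lintegral_finsetSum_measure, lintegral_smul_measure, smul_eq_mul]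
  exact Finset.sum_congr rfl fun i _ => by rw [lintegral_map hh measurable_prodMk_left]

theorem map_snd_labelledMixture :
    (labelledMixture w N).map Prod.snd = ∑ i, ENNReal.ofReal (w i) • N i := by
  ext s hs
  rw [Measure.map_apply measurable_snd hs]
  simp only [labelledMixture, Measure.coe_finsetSum, Finset.sum_apply, Measure.smul_apply]
  refine Finset.sum_congr rfl fun i _ => ?_
  rw [Measure.map_apply measurable_prodMk_left (measurable_snd hs)]
  rfl

theorem sum_ofReal_weights (hw : ∀ i, 0 < w i) (hw1 : ∑ i, w i = 1) :
    ∑ i, ENNReal.ofReal (w i) = 1 := by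
  rw [← ENNReal.ofReal_sum_of_nonneg fun i _ => (hw i).le, hw1, ENNReal.ofReal_one]

theorem isProbabilityMeasure_labelledMixture [∀ i, IsProbabilityMeasure (N i)]
    (hw : ∀ i, 0 < w i) (hw1 : ∑ i, w i = 1) :
    IsProbabilityMeasure (labelledMixture w N) := by
  constructor
  have h := lintegral_labelledMixture (w := w) (N := N) (h := fun _ => 1) measurable_const
  simpa [sum_ofReal_weights hw hw1] using h

theorem labelledMixture_label_and (hw : ∀ i, 0 < w i) (i : Fin k) {A : Set E}
    (hA : MeasurableSet A) :
    (labelledMixture w N).real {q | q.1 = i ∧ q.2 ∈ A} = w i * (N i).real A := by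
  have hm : MeasurableSet {q : Fin k × E | q.1 = i ∧ q.2 ∈ A} :=
    (measurable_fst (measurableSet_singleton i)).inter (measurable_snd hA)
  have h : labelledMixture w N {q | q.1 = i ∧ q.2 ∈ A} = ENNReal.ofReal (w i) * N i A := by
    simp only [labelledMixture, Measure.coe_finsetSum, Finset.sum_apply, Measure.smul_apply,
      smul_eq_mul]
    rw [Finset.sum_eq_single i]
    · rw [Measure.map_apply measurable_prodMk_left hm]
      simp
    · intro j _ hj
      rw [Measure.map_apply measurable_prodMk_left hm]
      simp [hj]
    · simp
  rw [measureReal_def, h, ENNReal.toReal_mul, ENNReal.toReal_ofReal (hw i).le, measureReal_def]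

theorem labelledMixture_label [∀ i, IsProbabilityMeasure (N i)] (hw : ∀ i, 0 < w i) (i : Fin k) :
    (labelledMixture w N).real {q | q.1 = i} = w i := by
  simpa using labelledMixture_label_and (N := N) hw i MeasurableSet.univ

/-- An exponential moment that involves one component only. -/
theorem lintegral_exp_label_le [∀ i, IsProbabilityMeasure (N i)] (hw : ∀ i, 0 < w i)
    (hw1 : ∑ i, w i = 1) (i : Fin k) {g : E → ℝ}
    (hg : Measurable g) {c : ℝ} (hc : 0 ≤ c)
    (h : ∫⁻ x, ENNReal.ofReal (Real.exp (g x)) ∂(N i) ≤ ENNReal.ofReal (1 + c)) :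
    ∫⁻ q : Fin k × E, ENNReal.ofReal (Real.exp (if q.1 = i then g q.2 else 0))
      ∂(labelledMixture w N) ≤ ENNReal.ofReal (Real.exp (w i * c)) := by
  have hm : Measurable fun q : Fin k × E =>
      ENNReal.ofReal (Real.exp (if q.1 = i then g q.2 else 0)) := by
    refine (Real.measurable_exp.comp (Measurable.ite ?_ (hg.comp measurable_snd)
      measurable_const)).ennreal_ofReal
    exact measurable_fst (measurableSet_singleton i)
  have hle : ∀ j, ENNReal.ofReal (w j) *
      ∫⁻ x, ENNReal.ofReal (Real.exp (if j = i then g x else 0)) ∂(N j) ≤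
      ENNReal.ofReal (w j * (1 + if j = i then c else 0)) := by
    intro j
    rw [ENNReal.ofReal_mul (hw j).le]
    refine mul_le_mul_right ?_ _
    by_cases hj : j = i
    · subst hj
      simpa using h
    · simp [hj]
  rw [lintegral_labelledMixture hm]
  refine (Finset.sum_le_sum fun j _ => hle j).trans ?_
  rw [← ENNReal.ofReal_sum_of_nonneg fun j _ => mul_nonneg (hw j).le (by split_ifs <;> linarith)]
  refine ENNReal.ofReal_le_ofReal ?_
  simp only [mul_add, mul_one, Finset.sum_add_distrib, hw1, mul_ite, mul_zero, Finset.sum_ite_eq',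
    Finset.mem_univ, if_true]
  linarith [Real.add_one_le_exp (w i * c)]

end Labelled

/-! ### Typical and separated samples -/

section Events

open scoped Classical

variable {E : Type*} [MetricSpace E] {ι : Type*} {k : ℕ}

/-- The labelled points with indices in `S` are spread around the centers `μ i` of their components
as expected, at the scale `r i`. -/
structure IsTypical (w : Fin k → ℝ) (μ : Fin k → E) (r : Fin k → ℝ) (S : Finset ι)
    (p : ι → Fin k × E) : Prop where
  sum_le : ∀ i, ∑ j ∈ S, (if (p j).1 = i then dist (p j).2 (μ i) ^ 2 else 0) ≤
    8 * w i * S.card * r i ^ 2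
  card_le : ∀ i, ((S.filter fun j => (p j).1 = i).card : ℝ) ≤ 3 * w i * S.card
  le_card : ∀ i, w i * S.card / 4 ≤
    ((S.filter fun j => (p j).1 = i ∧ dist (p j).2 (μ i) ≤ 3 * r i).card : ℝ)

/-- Whatever at most `q` of the points with indices in `U` are taken as centers, few of the
other points with indices in `S` are close to them. -/
def IsSeparated (w : Fin k → ℝ) (r : Fin k → ℝ) (q : ℕ) (S U : Finset ι) (p : ι → Fin k × E) :
    Prop :=
  ∀ J ⊆ U, J.card ≤ q → ∀ i,
    (((S \ J).filter fun j => (p j).1 = i ∧ ∃ a ∈ J, dist (p j).2 (p a).2 < r i / 2).card : ℝ) ≤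
      w i * S.card / 8

end Events

section Measurability

open scoped Classical

variable {E : Type*} [MeasurableSpace E] {ι : Type*} {k : ℕ}

theorem measurable_card_filter {Ω : Type*} [MeasurableSpace Ω] (S : Finset ι) {P : Ω → ι → Prop}
    [∀ x, DecidablePred (P x)] (hP : ∀ j ∈ S, MeasurableSet {x | P x j}) :
    Measurable fun x => ((S.filter (P x)).card : ℝ) := by
  have : (fun x => ((S.filter (P x)).card : ℝ)) =
      fun x => ∑ j ∈ S, {x | P x j}.indicator (fun _ => (1 : ℝ)) x := by
    ext x
    rw [Finset.card_filter]
    push_cast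
    exact Finset.sum_congr rfl fun j _ => by simp [Set.indicator_apply]
  rw [this]
  exact Finset.measurable_sum _ fun j hj => measurable_const.indicator (hP j hj)

theorem sum_indicator_eq {Ω : Type*} (S : Finset ι) (A : Set Ω) (t : ℝ) (p : ι → Ω) :
    ∑ j ∈ S, A.indicator (fun _ => t) (p j) = t * (S.filter fun j => p j ∈ A).card := by
  rw [Finset.card_filter]
  push_cast
  rw [Finset.mul_sum]
  exact Finset.sum_congr rfl fun j _ => by simp [Set.indicator_apply]

theorem measurableSet_label (j : ι) (i : Fin k) :
    MeasurableSet {p : ι → Fin k × E | (p j).1 = i} :=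
  (measurable_fst.comp (measurable_pi_apply j)) (measurableSet_singleton i)

variable [MetricSpace E] [BorelSpace E] [SecondCountableTopology E]

theorem measurableSet_isTypical (w : Fin k → ℝ) (μ : Fin k → E)
    (r : Fin k → ℝ) (S : Finset ι) :
    MeasurableSet {p : ι → Fin k × E | IsTypical w μ r S p} := by
  have h : {p : ι → Fin k × E | IsTypical w μ r S p} = ⋂ i,
      ({p | ∑ j ∈ S, (if (p j).1 = i then dist (p j).2 (μ i) ^ 2 else 0) ≤
          8 * w i * S.card * r i ^ 2} ∩
        ({p | ((S.filter fun j => (p j).1 = i).card : ℝ) ≤ 3 * w i * S.card} ∩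
        {p | w i * S.card / 4 ≤
          ((S.filter fun j => (p j).1 = i ∧ dist (p j).2 (μ i) ≤ 3 * r i).card : ℝ)})) := by
    ext p
    simp only [Set.mem_ofPred_eq, Set.mem_iInter, Set.mem_inter_iff]
    exact ⟨fun h i => ⟨h.sum_le i, h.card_le i, h.le_card i⟩,
      fun h => ⟨fun i => (h i).1, fun i => (h i).2.1, fun i => (h i).2.2⟩⟩
  rw [h]
  refine MeasurableSet.iInter fun i => ?_
  have hclose : ∀ j ∈ S, MeasurableSet {p : ι → Fin k × E |
      (p j).1 = i ∧ dist (p j).2 (μ i) ≤ 3 * r i} := fun j _ =>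
    (measurableSet_label j i).inter (measurableSet_le
      (f := fun p : ι → Fin k × E => dist (p j).2 (μ i)) (by fun_prop) measurable_const)
  refine (measurableSet_le (Finset.measurable_sum _ fun j _ => Measurable.ite
    (measurableSet_label j i) (by fun_prop) measurable_const) measurable_const).inter
    ((measurableSet_le (measurable_card_filter S fun j _ => measurableSet_label j i)
      measurable_const).inter
    (measurableSet_le measurable_const (measurable_card_filter S hclose)))

theorem measurableSet_near (r : Fin k → ℝ) (J S : Finset ι) (i : Fin k)
    (c : ℝ) :
    MeasurableSet {p : ι → Fin k × E | (((S \ J).filter fun j => (p j).1 = i ∧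
      ∃ a ∈ J, dist (p j).2 (p a).2 < r i / 2).card : ℝ) ≤ c} := by
  have hnear : ∀ j, MeasurableSet {p : ι → Fin k × E | (p j).1 = i ∧
      ∃ a ∈ J, dist (p j).2 (p a).2 < r i / 2} := by
    intro j
    have : {p : ι → Fin k × E | (p j).1 = i ∧ ∃ a ∈ J, dist (p j).2 (p a).2 < r i / 2} =
        {p | (p j).1 = i} ∩ ⋃ a ∈ J, {p | dist (p j).2 (p a).2 < r i / 2} := by
      ext p
      simp
    rw [this]
    exact (measurableSet_label j i).inter (J.measurableSet_biUnion fun a _ =>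
      measurableSet_lt (by fun_prop) measurable_const)
  exact measurableSet_le (measurable_card_filter (S \ J) fun j _ => hnear j) measurable_const

theorem measurableSet_isSeparated (w : Fin k → ℝ) (r : Fin k → ℝ)
    (q : ℕ) (S U : Finset ι) :
    MeasurableSet {p : ι → Fin k × E | IsSeparated w r q S U p} := by
  have : {p : ι → Fin k × E | IsSeparated w r q S U p} =
      ⋂ J ∈ U.powerset, ⋂ (_ : J.card ≤ q), ⋂ i, {p | (((S \ J).filter fun j => (p j).1 = i ∧
        ∃ a ∈ J, dist (p j).2 (p a).2 < r i / 2).card : ℝ) ≤ w i * S.card / 8} := by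
    ext p
    simp only [IsSeparated, Set.mem_ofPred_eq, Set.mem_iInter, Finset.mem_powerset]
  rw [this]
  exact Finset.measurableSet_biInter _ fun J _ => MeasurableSet.iInter fun _ =>
    MeasurableSet.iInter fun i => measurableSet_near r J S i _

variable [Fintype ι] {w : Fin k → ℝ} {N : Fin k → Measure E} [∀ i, IsProbabilityMeasure (N i)]
  {μ : Fin k → E} {r : Fin k → ℝ}

/-- A Chernoff bound for each of the three properties and each component. The first two have
exponent at most `-w i * |S|`; the third, the number of points near the mean, is the weakest, with
`-(3/10 - 1/4) * w i * |S|`, whence the `1/20`. -/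
theorem pi_not_isTypical_le (hw : ∀ i, 0 < w i) (hw1 : ∑ i, w i = 1)
    (hr : ∀ i, 0 < r i)
    (hN : ∀ i, ∫⁻ x, ENNReal.ofReal (Real.exp (dist x (μ i) ^ 2 / (4 * r i ^ 2))) ∂(N i) ≤
      ENNReal.ofReal (√2)) {ω : ℝ} (hω : ∀ i, ω ≤ w i) (S : Finset ι) :
    (Measure.pi fun _ : ι => labelledMixture w N) {p | ¬ IsTypical w μ r S p} ≤
      ENNReal.ofReal (3 * k * Real.exp (-(ω * S.card / 20))) := by
  have := isProbabilityMeasure_labelledMixture (N := N) hw hw1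
  set P := Measure.pi fun _ : ι => labelledMixture w N
  set B : ℝ≥0∞ := ENNReal.ofReal (Real.exp (-(ω * S.card / 20)))
  have hs : (0 : ℝ) ≤ S.card := Nat.cast_nonneg _
  have h1 : ∀ i, P {p | 2 * w i * S.card ≤
      ∑ j ∈ S, if (p j).1 = i then dist (p j).2 (μ i) ^ 2 / (4 * r i ^ 2) else 0} ≤ B := by
    intro i
    have h2 : √2 ≤ 1 + 1 := by rw [Real.sqrt_le_left (by norm_num)]; norm_num
    refine (pi_le_sum_le_exp (labelledMixture w N)
      (f := fun q => if q.1 = i then dist q.2 (μ i) ^ 2 / (4 * r i ^ 2) else 0)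
      (Measurable.ite (measurable_fst (measurableSet_singleton i)) (by fun_prop) measurable_const) S
      (lintegral_exp_label_le hw hw1 i (by fun_prop) zero_le_one
        ((hN i).trans (ENNReal.ofReal_le_ofReal h2))) _).trans ?_
    refine ENNReal.ofReal_le_ofReal (Real.exp_le_exp.2 ?_)
    nlinarith [mul_le_mul_of_nonneg_right (hω i) hs, mul_nonneg (hw i).le hs]
  have h2 : ∀ i, P {p | 3 * w i * S.card ≤
      ∑ j ∈ S, {q : Fin k × E | q.1 = i}.indicator (fun _ => (1 : ℝ)) (p j)} ≤ B := by
    intro i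
    have hm : MeasurableSet {q : Fin k × E | q.1 = i} :=
      measurable_fst (measurableSet_singleton i)
    refine (pi_le_sum_le_exp (labelledMixture w N) (measurable_const.indicator hm) S
      (lintegral_exp_indicator_le _ hm (p := w i * 2) ?_) _).trans ?_
    · rw [labelledMixture_label hw]
      have := Real.exp_one_lt_d9
      exact mul_le_mul_of_nonneg_left (by linarith) (hw i).le
    refine ENNReal.ofReal_le_ofReal (Real.exp_le_exp.2 ?_)
    nlinarith [mul_le_mul_of_nonneg_right (hω i) hs, mul_nonneg (hw i).le hs]
  have h3 : ∀ i, P {p | -(w i * S.card / 4) ≤ ∑ j ∈ S,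
      {q : Fin k × E | q.1 = i ∧ q.2 ∈ {x | dist x (μ i) ≤ 3 * r i}}.indicator
        (fun _ => (-1 : ℝ)) (p j)} ≤ B := by
    intro i
    have hm' : MeasurableSet {x | dist x (μ i) ≤ 3 * r i} :=
      measurableSet_le (by fun_prop) measurable_const
    have hm : MeasurableSet {q : Fin k × E | q.1 = i ∧ q.2 ∈ {x | dist x (μ i) ≤ 3 * r i}} :=
      (measurable_fst (measurableSet_singleton i)).inter (measurable_snd hm')
    refine (pi_le_sum_le_exp (labelledMixture w N) (measurable_const.indicator hm) S
      (lintegral_exp_indicator_le _ hm (p := -(w i * (3 / 10))) ?_) _).trans ?_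
    · rw [labelledMixture_label_and hw i hm']
      have he := Real.exp_neg_one_lt_d9
      -- Markov's inequality: beyond `3 * r i` the exponential is at least `exp (9/4) ≥ 4`, and its
      -- mean is at most `√2`.
      have hge : 1 / 2 ≤ (N i).real {x | dist x (μ i) ≤ 3 * r i} := by
        have hc : (N i).real {x | dist x (μ i) ≤ 3 * r i}ᶜ ≤ 1 / 2 := by
          have hr2 : (0 : ℝ) < 4 * r i ^ 2 := by have := hr i; positivity
          refine ENNReal.toReal_le_of_le_ofReal (by norm_num) ?_
          refine (measure_mono ?_).trans ((meas_ge_le_lintegral_div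
            (f := fun x => ENNReal.ofReal (Real.exp (dist x (μ i) ^ 2 / (4 * r i ^ 2))))
            (ε := ENNReal.ofReal 4) (by fun_prop) (by norm_num)
            ENNReal.ofReal_ne_top).trans ((ENNReal.div_le_div_right (hN i) _).trans ?_))
          · intro x hx
            simp only [Set.mem_compl_iff, Set.mem_ofPred_eq, not_le] at hx ⊢
            refine ENNReal.ofReal_le_ofReal ?_
            have h9 : 2 ≤ dist x (μ i) ^ 2 / (4 * r i ^ 2) := by
              rw [le_div_iff₀ hr2]
              nlinarith [hr i, mul_pos (hr i) (hr i)]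
            have h4 : (4 : ℝ) ≤ Real.exp 2 := by
              rw [show (2 : ℝ) = 1 + 1 by norm_num, Real.exp_add]
              nlinarith [Real.exp_one_gt_d9]
            exact h4.trans (Real.exp_le_exp.2 h9)
          · rw [← ENNReal.ofReal_div_of_pos (by norm_num)]
            refine ENNReal.ofReal_le_ofReal ?_
            have h2 : √2 ≤ 2 := by rw [Real.sqrt_le_left (by norm_num)]; norm_num
            linarith
        rw [measureReal_compl hm'] at hc
        simp at hc
        linarith
      have := hw i
      nlinarith [mul_le_mul_of_nonneg_left hge this.le,
        mul_nonneg (mul_nonneg this.le (measureReal_nonneg (μ := N i)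
          (s := {x | dist x (μ i) ≤ 3 * r i}))) (by linarith : (0 : ℝ) ≤ 0.37 - Real.exp (-1))]
    refine ENNReal.ofReal_le_ofReal (Real.exp_le_exp.2 ?_)
    nlinarith [mul_le_mul_of_nonneg_right (hω i) hs, mul_nonneg (hw i).le hs]
  have hsub : {p : ι → Fin k × E | ¬ IsTypical w μ r S p} ⊆ ⋃ i,
      (({p | 2 * w i * S.card ≤
        ∑ j ∈ S, if (p j).1 = i then dist (p j).2 (μ i) ^ 2 / (4 * r i ^ 2) else 0} ∪
      {p | 3 * w i * S.card ≤
        ∑ j ∈ S, {q : Fin k × E | q.1 = i}.indicator (fun _ => (1 : ℝ)) (p j)}) ∪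
      {p | -(w i * S.card / 4) ≤ ∑ j ∈ S,
        {q : Fin k × E | q.1 = i ∧ q.2 ∈ {x | dist x (μ i) ≤ 3 * r i}}.indicator
          (fun _ => (-1 : ℝ)) (p j)}) := by
    intro p hp
    by_contra hcon
    simp only [Set.mem_iUnion, Set.mem_union, Set.mem_ofPred_eq, not_exists, not_or, not_le,
      sum_indicator_eq] at hcon
    refine hp ⟨fun i => ?_, fun i => ?_, fun i => ?_⟩
    · have := (hcon i).1.1.le
      have hr2 : (0 : ℝ) < 4 * r i ^ 2 := by have := hr i; positivity
      have he : ∀ j, (if (p j).1 = i then dist (p j).2 (μ i) ^ 2 / (4 * r i ^ 2) else 0) =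
          (if (p j).1 = i then dist (p j).2 (μ i) ^ 2 else 0) / (4 * r i ^ 2) := fun j => by
        split_ifs <;> simp
      simp_rw [he] at this
      rw [← Finset.sum_div, div_le_iff₀ hr2] at this
      linarith
    · have := (hcon i).1.2.le
      linarith
    · have := (hcon i).2.le
      linarith
  refine (measure_mono hsub).trans ((measure_iUnion_le _).trans ?_)
  rw [tsum_fintype]
  refine (Finset.sum_le_sum fun i _ => (measure_union_le _ _).trans
    (add_le_add ((measure_union_le _ _).trans (add_le_add (h1 i) (h2 i))) (h3 i))).trans ?_
  rw [Finset.sum_const, Finset.card_univ, Fintype.card_fin, nsmul_eq_mul,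
    ENNReal.ofReal_mul (by positivity), mul_comm (3 : ℝ), ENNReal.ofReal_mul (by positivity),
    ENNReal.ofReal_natCast, mul_assoc]
  refine mul_le_mul_right (le_of_eq ?_) _
  simp only [B]
  rw [show ENNReal.ofReal 3 = 3 by simp]
  ring

/-- Once the points of `J` are frozen, the other points are still independent, and one of them is
near `J` with probability at most `q * p₀`. Chernoff with the large parameter `64 / ω` gives `exp
(|S| - 8 |S|)`; its moment stays bounded because `q * p₀ ≤ exp (-(64 / ω))`. The crude count of at
most `2 ^ |U| ≤ exp (6 |S|)` sets `J` then leaves `exp (-|S|)`. -/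
theorem pi_not_isSeparated_le (hw : ∀ i, 0 < w i)
    (hw1 : ∑ i, w i = 1) {ω p₀ : ℝ} (hω0 : 0 < ω) (hp₀ : 0 ≤ p₀)
    (hN : ∀ i c, N i {x | dist x c < r i / 2} ≤ ENNReal.ofReal p₀) (hω : ∀ i, ω ≤ w i) {q : ℕ}
    (hq : q * p₀ ≤ Real.exp (-(64 / ω))) (S U : Finset ι) (hU : (U.card : ℝ) ≤ 6 * S.card) :
    (Measure.pi fun _ : ι => labelledMixture w N) {p | ¬ IsSeparated w r q S U p} ≤
      ENNReal.ofReal (k * Real.exp (-S.card)) := by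
  have := isProbabilityMeasure_labelledMixture (N := N) hw hw1
  set P := Measure.pi fun _ : ι => labelledMixture w N
  have hs : (0 : ℝ) ≤ S.card := Nat.cast_nonneg _
  have h1 : ∀ J : Finset ι, J.card ≤ q → ∀ i, P {p | (((S \ J).filter fun j => (p j).1 = i ∧
      ∃ a ∈ J, dist (p j).2 (p a).2 < r i / 2).card : ℝ) ≤ w i * S.card / 8}ᶜ ≤
      ENNReal.ofReal (Real.exp (-(7 * S.card))) := by
    intro J hJ i
    refine pi_le_of_forall_piecewise _ J (measurableSet_near r J S i _).compl fun y => ?_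
    set A : Set E := {x | ∃ a ∈ J, dist x (y a).2 < r i / 2} with hA
    have hAU : A = ⋃ a ∈ J, {x | dist x (y a).2 < r i / 2} := by
      ext x
      simp [hA]
    have hAm : MeasurableSet A := by
      rw [hAU]
      exact J.measurableSet_biUnion fun a _ => measurableSet_lt (by fun_prop) measurable_const
    have hm : MeasurableSet {q : Fin k × E | q.1 = i ∧ q.2 ∈ A} :=
      (measurable_fst (measurableSet_singleton i)).inter (measurable_snd hAm)
    have hNA : (N i).real A ≤ q * p₀ := by
      refine ENNReal.toReal_le_of_le_ofReal (by positivity) ?_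
      rw [hAU]
      refine (measure_biUnion_finset_le _ _).trans ((Finset.sum_le_sum fun a _ => hN i _).trans ?_)
      rw [Finset.sum_const, nsmul_eq_mul, ENNReal.ofReal_mul (by positivity),
        ENNReal.ofReal_natCast]
      exact mul_le_mul_left (by exact_mod_cast hJ) _
    have hwi : w i ≤ 1 := hw1 ▸ Finset.single_le_sum (fun j _ => (hw j).le) (Finset.mem_univ i)
    have hC := pi_le_sum_le_exp (labelledMixture w N) (measurable_const.indicator hm) (S \ J)
      (lintegral_exp_indicator_le _ hm (t := 64 / ω) (p := 1) (by
        rw [labelledMixture_label_and hw i hAm]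
        have h0 : (0 : ℝ) ≤ (N i).real A := measureReal_nonneg
        have hprod : (N i).real A * Real.exp (64 / ω) ≤ 1 := by
          calc _ ≤ Real.exp (-(64 / ω)) * Real.exp (64 / ω) :=
                mul_le_mul_of_nonneg_right (hNA.trans hq) (Real.exp_nonneg _)
            _ = 1 := by rw [← Real.exp_add]; simp
        nlinarith [mul_nonneg (hw i).le h0, hw i,
          mul_nonneg h0 (Real.exp_nonneg (64 / ω))])) (64 / ω * (w i * S.card / 8))
    refine (measure_mono ?_).trans (hC.trans (ENNReal.ofReal_le_ofReal (Real.exp_le_exp.2 ?_)))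
    · intro x hx
      simp only [Set.mem_compl_iff, Set.mem_ofPred_eq, not_le] at hx ⊢
      rw [sum_indicator_eq]
      refine mul_le_mul_of_nonneg_left (hx.le.trans (le_of_eq ?_)) (by positivity)
      refine congrArg Nat.cast (congrArg Finset.card (Finset.ext fun j => ?_))
      simp only [Finset.mem_filter]
      refine and_congr_right fun hj => ?_
      -- Only points outside `J` are counted, so in the resampled family the centers come from `y`
      -- and the counted points from `x`.
      have hj' : j ∉ J := (Finset.mem_sdiff.1 hj).2
      simp only [Finset.piecewise_eq_of_notMem _ _ _ hj', hA, Set.mem_ofPred_eq]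
      refine and_congr_right fun _ => exists_congr fun a => and_congr_right fun ha => ?_
      rw [Finset.piecewise_eq_of_mem _ _ _ ha]
    · have hcard : ((S \ J).card : ℝ) ≤ S.card := by
        exact_mod_cast Finset.card_le_card Finset.sdiff_subset
      have h8 : 8 * (S.card : ℝ) ≤ 64 / ω * (w i * S.card / 8) := by
        calc 8 * (S.card : ℝ) = 64 / ω * (ω * S.card / 8) := by field_simp; ring
          _ ≤ _ := by gcongr; exact hω i
      linarith
  have hsub : {p : ι → Fin k × E | ¬ IsSeparated w r q S U p} ⊆
      ⋃ J ∈ U.powerset.filter fun J => J.card ≤ q, ⋃ i ∈ (Finset.univ : Finset (Fin k)),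
      {p | (((S \ J).filter fun j => (p j).1 = i ∧
        ∃ a ∈ J, dist (p j).2 (p a).2 < r i / 2).card : ℝ) ≤ w i * S.card / 8}ᶜ := by
    intro p hp
    simp only [IsSeparated, Set.mem_ofPred_eq, not_forall] at hp
    obtain ⟨J, hJ, hJq, i, hi⟩ := hp
    simp only [Set.mem_iUnion]
    exact ⟨J, Finset.mem_filter.2 ⟨Finset.mem_powerset.2 hJ, hJq⟩, i, Finset.mem_univ i, hi⟩
  refine (measure_mono hsub).trans ((measure_biUnion_finset_le _ _).trans
    ((Finset.sum_le_sum fun J hJ => (measure_biUnion_finset_le _ _).trans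
      (Finset.sum_le_sum fun i _ => h1 J (Finset.mem_filter.1 hJ).2 i)).trans ?_))
  simp only [Finset.sum_const, Finset.card_univ, Fintype.card_fin, nsmul_eq_mul]
  rw [← ENNReal.ofReal_natCast, ← ENNReal.ofReal_natCast, ← ENNReal.ofReal_mul (by positivity),
    ← ENNReal.ofReal_mul (by positivity)]
  refine ENNReal.ofReal_le_ofReal ?_
  have hpow : ((U.powerset.filter fun J => J.card ≤ q).card : ℝ) ≤ Real.exp (6 * S.card) := by
    calc ((U.powerset.filter fun J => J.card ≤ q).card : ℝ) ≤ (2 ^ U.card : ℕ) := by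
          exact_mod_cast (Finset.card_filter_le _ _).trans (Finset.card_powerset U).le
      _ ≤ Real.exp 1 ^ U.card := by
          push_cast
          exact pow_le_pow_left₀ (by norm_num) (by linarith [Real.exp_one_gt_d9]) _
      _ = Real.exp U.card := by rw [← Real.exp_nat_mul, mul_one]
      _ ≤ _ := Real.exp_le_exp.2 hU
  calc _ ≤ Real.exp (6 * S.card) * (k * Real.exp (-(7 * S.card))) := by gcongr
    _ = k * (Real.exp (6 * S.card) * Real.exp (-(7 * S.card))) := by ring
    _ = k * Real.exp (-S.card) := by rw [← Real.exp_add]; ring_nf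

end Measurability

/-! ### Costs of data sets given by indexed points -/

section IndexedCost

open scoped Classical

variable {E : Type*} [MetricSpace E] {ι : Type*}

/-- Nonemptiness matters: the distance to the empty set is `∞` for `Metric.infEDist` but `0` for
`Metric.infDist`. -/
theorem infEDist_eq_ofReal_infDist {T : Finset E} (hT : T.Nonempty) (x : E) :
    Metric.infEDist x (T : Set E) = ENNReal.ofReal (Metric.infDist x (T : Set E)) :=
  (ENNReal.ofReal_toReal (Metric.infEDist_ne_top hT)).symm

theorem infEDist_sq_eq_ofReal {T : Finset E} (hT : T.Nonempty) (x : E) :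
    Metric.infEDist x (T : Set E) ^ 2 = ENNReal.ofReal (Metric.infDist x (T : Set E) ^ 2) := by
  rw [infEDist_eq_ofReal_infDist hT, ENNReal.ofReal_pow Metric.infDist_nonneg]

theorem cost_map_eq_ofReal {T : Finset E} (hT : T.Nonempty) (S : Finset ι) (x : ι → E) :
    cost (S.val.map x) T = ENNReal.ofReal (∑ j ∈ S, Metric.infDist (x j) (T : Set E) ^ 2) := by
  rw [ENNReal.ofReal_sum_of_nonneg fun j _ => sq_nonneg _, cost, Multiset.map_map]
  exact Finset.sum_congr rfl fun j _ => infEDist_sq_eq_ofReal hT _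

theorem cost_map_empty {S : Finset ι} (hS : S.Nonempty) (x : ι → E) :
    cost (S.val.map x) ∅ = ⊤ := by
  obtain ⟨j, hj⟩ := hS
  rw [cost, Multiset.map_map, eq_top_iff]
  refine le_trans ?_ (Finset.single_le_sum
    (f := fun j => Metric.infEDist (x j) ((∅ : Finset E) : Set E) ^ 2) (fun _ _ => zero_le) hj)
  simp

/-- If many points of a data set are far from `T`, then the truncated cost of `T` is large. -/
theorem le_truncCost_map {T : Finset E} (hT : T.Nonempty) {G S : Finset ι} (hG : G ⊆ S)
    (x : ι → E) (l : ℕ) {a : ℝ} (ha : 0 ≤ a)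
    (h : ∀ j ∈ G, a ≤ Metric.infDist (x j) (T : Set E) ^ 2) :
    ENNReal.ofReal ((G.card - l) * a) ≤ truncCost l (S.val.map x) T := by
  refine le_iInf₂ fun R hR => ?_
  obtain ⟨hRS, hcard⟩ := hR
  set P : E → Prop := fun y => ENNReal.ofReal a ≤ Metric.infEDist y (T : Set E) ^ 2 with hP
  have h1 : G.card ≤ (S.val.map x).countP P := by
    rw [Multiset.countP_map]
    refine Finset.card_le_card (s := G) (t := S.filter fun j => P (x j)) fun j hj => ?_
    rw [Finset.mem_filter]
    refine ⟨hG hj, ?_⟩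
    simp only [hP]
    rw [infEDist_sq_eq_ofReal hT]
    exact ENNReal.ofReal_le_ofReal (h j hj)
  -- At most `l` points are removed, so at least `G.card - l` points of cost at least `a` survive in
  -- `R`.
  have h2 : (S.val.map x).countP P ≤ R.countP P + l := by
    rw [← Multiset.sub_add_cancel hRS, Multiset.countP_add, add_comm]
    have h3 := Multiset.countP_le_card P (S.val.map x - R)
    rw [Multiset.card_sub hRS] at h3
    omega
  have h3 : (R.countP P : ℝ≥0∞) * ENNReal.ofReal a ≤ cost R T := by
    rw [cost, ← nsmul_eq_mul, Multiset.countP_eq_card_filter]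
    nth_rw 2 [← Multiset.filter_add_not P R]
    rw [Multiset.map_add, Multiset.sum_add]
    refine le_trans ?_ le_self_add
    have := Multiset.card_nsmul_le_sum (s := (R.filter P).map fun y =>
      Metric.infEDist y (T : Set E) ^ 2) (a := ENNReal.ofReal a) (by
        intro y hy
        obtain ⟨z, hz, rfl⟩ := Multiset.mem_map.1 hy
        exact (Multiset.mem_filter.1 hz).2)
    simpa using this
  refine le_trans ?_ h3
  rw [← ENNReal.ofReal_natCast, ← ENNReal.ofReal_mul (by positivity)]
  refine ENNReal.ofReal_le_ofReal (mul_le_mul_of_nonneg_right ?_ ha)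
  have : (G.card : ℝ) ≤ R.countP P + l := by exact_mod_cast h1.trans h2
  linarith

/-- A set of points of a data set is the image of a set of indices of the same size. -/
theorem exists_index_set {E ι : Type*} {S : Finset ι} {x : ι → E} {T : Finset E}
    (hT : ∀ y ∈ T, y ∈ S.val.map x) :
    ∃ J ⊆ S, J.card ≤ T.card ∧ J.image x = T := by
  have h : ∀ y : T, ∃ j ∈ S, x j = y := fun y => by
    simpa using Multiset.mem_map.1 (hT y y.2)
  choose f hf hfx using h
  refine ⟨Finset.univ.image f, ?_, ?_, ?_⟩
  · intro j hj
    obtain ⟨y, -, rfl⟩ := Finset.mem_image.1 hj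
    exact hf y
  · exact Finset.card_image_le.trans (by simp)
  · ext y
    simp only [Finset.mem_image, Finset.mem_univ, true_and, exists_exists_eq_and, hfx]
    simp

end IndexedCost

/-! ### Costs on typical and separated samples -/

section TypicalCost

open scoped Classical

variable {ι : Type*} {k : ℕ}

theorem sum_eq_sum_label {E : Type*} (S : Finset ι) (p : ι → Fin k × E) (g : ι → ℝ) :
    ∑ j ∈ S, g j = ∑ i, ∑ j ∈ S.filter (fun j => (p j).1 = i), g j :=
  (Finset.sum_fiberwise S (fun j => (p j).1) g).symm

variable {E : Type*} [MetricSpace E] {w r : Fin k → ℝ} {μ : Fin k → E} {S U J : Finset ι}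
  {p : ι → Fin k × E} {T : Finset E}

theorem IsTypical.sum_filter_le (h : IsTypical w μ r S p) (i : Fin k) :
    ∑ j ∈ S.filter (fun j => (p j).1 = i), dist (p j).2 (μ i) ^ 2 ≤
      8 * w i * S.card * r i ^ 2 := by
  rw [Finset.sum_filter]
  exact h.sum_le i

theorem infDist_sq_le_of_dist_le (e m : E) {t : E} (ht : t ∈ T) {ρ : ℝ}
    (h : dist t m ≤ 3 * ρ) :
    Metric.infDist e (T : Set E) ^ 2 ≤ 2 * dist e m ^ 2 + 18 * ρ ^ 2 := by
  have h1 : Metric.infDist e (T : Set E) ≤ dist e m + 3 * ρ :=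
    (Metric.infDist_le_dist_of_mem ht).trans
      ((dist_triangle_right e t m).trans (add_le_add le_rfl h))
  have h2 := pow_le_pow_left₀ Metric.infDist_nonneg h1 2
  nlinarith [sq_nonneg (dist e m - 3 * ρ)]

/-- Many points of each component are far from every small set of centers. -/
theorem IsSeparated.le_card_far {q : ℕ} (hs : IsSeparated w r q S U p)
    (h : IsTypical w μ r S p) (hJU : J ⊆ U) (hJq : J.card ≤ q) (hJ : J.Nonempty) (i : Fin k) :
    w i * S.card / 8 - q ≤ ((S.filter fun j => (p j).1 = i ∧
      r i / 2 ≤ Metric.infDist (p j).2 (J.image fun j => (p j).2 : Finset E)).card : ℝ) := by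
  have h1 := h.le_card i
  have h2 := hs J hJU hJq i
  have hsub : (S.filter fun j => (p j).1 = i ∧ dist (p j).2 (μ i) ≤ 3 * r i) ⊆
      ((S.filter fun j => (p j).1 = i ∧
        r i / 2 ≤ Metric.infDist (p j).2 (J.image fun j => (p j).2 : Finset E)) ∪
      ((S \ J).filter fun j => (p j).1 = i ∧ ∃ a ∈ J, dist (p j).2 (p a).2 < r i / 2)) ∪ J := by
    intro j hj
    obtain ⟨hjS, hji, -⟩ := Finset.mem_filter.1 hj
    by_cases hjJ : j ∈ J
    · exact Finset.mem_union_right _ hjJ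
    refine Finset.mem_union_left _ ?_
    by_cases hf : r i / 2 ≤ Metric.infDist (p j).2 (J.image fun j => (p j).2 : Finset E)
    · exact Finset.mem_union_left _ (Finset.mem_filter.2 ⟨hjS, hji, hf⟩)
    · refine Finset.mem_union_right _ (Finset.mem_filter.2
        ⟨Finset.mem_sdiff.2 ⟨hjS, hjJ⟩, hji, ?_⟩)
      rw [not_le, Metric.infDist_lt_iff (by simpa using hJ)] at hf
      obtain ⟨y, hy, hyd⟩ := hf
      obtain ⟨a, ha, rfl⟩ := Finset.mem_image.1 (Finset.mem_coe.1 hy)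
      exact ⟨a, ha, hyd⟩
  have h3 := (Finset.card_le_card hsub).trans
    ((Finset.card_union_le _ _).trans (Nat.add_le_add_right (Finset.card_union_le _ _) _))
  have h4 : (J.card : ℝ) ≤ q := by exact_mod_cast hJq
  have h5 : ((S.filter fun j => (p j).1 = i ∧ dist (p j).2 (μ i) ≤ 3 * r i).card : ℝ) ≤
      (S.filter fun j => (p j).1 = i ∧
        r i / 2 ≤ Metric.infDist (p j).2 (J.image fun j => (p j).2 : Finset E)).card +
      ((S \ J).filter fun j => (p j).1 = i ∧ ∃ a ∈ J, dist (p j).2 (p a).2 < r i / 2).card +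
      J.card := by exact_mod_cast h3
  linarith

/-- A lower bound for the optimal cost of a typical and separated sample. -/
theorem IsSeparated.le_optCost {q : ℕ} (hs : IsSeparated w r q S S p) (h : IsTypical w μ r S p)
    (hkq : k ≤ q) (hq : ∀ i, (q : ℝ) ≤ w i * S.card / 16) :
    ENNReal.ofReal (S.card * (∑ i, w i * r i ^ 2) / 64) ≤
      optCost (S.val.map fun j => (p j).2) k := by
  refine le_iInf₂ fun T hT => ?_
  obtain ⟨J, hJS, hJT, rfl⟩ := exists_index_set hT.1
  rcases S.eq_empty_or_nonempty with rfl | hSne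
  · simp
  rcases J.eq_empty_or_nonempty with rfl | hJ
  · rw [Finset.image_empty, cost_map_empty hSne]
    exact le_top
  have hJq : J.card ≤ q := (hJT.trans hT.2).trans hkq
  rw [cost_map_eq_ofReal (by simpa using hJ)]
  refine ENNReal.ofReal_le_ofReal ?_
  rw [sum_eq_sum_label S p, Finset.mul_sum, Finset.sum_div]
  refine Finset.sum_le_sum fun i _ => ?_
  set D : ι → ℝ := fun j => Metric.infDist (p j).2 (J.image fun j => (p j).2 : Finset E)
  set F := S.filter fun j => (p j).1 = i ∧ r i / 2 ≤ D j with hF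
  -- The scale is not assumed nonnegative here; typicality yields a point within `3 * r i` of `μ i`,
  -- which forces it.
  have hr : 0 ≤ r i := by
    by_contra hcon
    have h1 := h.le_card i
    have hpos : 0 < S.card := hSne.card_pos
    have h2 : (1 : ℝ) ≤ q := by exact_mod_cast (hJ.card_pos.trans_le hJq)
    have h3 : (0 : ℝ) < (S.filter fun j => (p j).1 = i ∧ dist (p j).2 (μ i) ≤ 3 * r i).card := by
      linarith [hq i]
    obtain ⟨j, hj⟩ := Finset.card_pos.1 (by exact_mod_cast h3)
    have := (Finset.mem_filter.1 hj).2.2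
    linarith [dist_nonneg (x := (p j).2) (y := μ i)]
  -- A share `1/8` is far up to `q` exceptions, and `q` costs at most `1/16`. With distance at least
  -- `r i / 2` this gives the factor `1/64`.
  have hfar : w i * S.card / 16 ≤ F.card := by
    have := hs.le_card_far h hJS hJq hJ i
    linarith [hq i]
  have h2 : F.card * (r i ^ 2 / 4) ≤ ∑ j ∈ F, D j ^ 2 := by
    rw [← nsmul_eq_mul]
    refine Finset.card_nsmul_le_sum _ _ _ fun j hj => ?_
    have := pow_le_pow_left₀ (by linarith) (Finset.mem_filter.1 hj).2.2 2
    linarith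
  calc _ = w i * S.card / 16 * (r i ^ 2 / 4) := by ring
    _ ≤ F.card * (r i ^ 2 / 4) := by gcongr
    _ ≤ _ := h2.trans (Finset.sum_le_sum_of_subset_of_nonneg
      (fun j hj => by
        obtain ⟨h3, h4, -⟩ := Finset.mem_filter.1 hj
        exact Finset.mem_filter.2 ⟨h3, h4⟩) fun j _ _ => sq_nonneg _)

/-- An upper bound for the optimal cost of a typical sample. -/
theorem IsTypical.optCost_le {q : ℕ} (h : IsTypical w μ r S p) (hk : 0 < k) (hkq : k ≤ q)
    (hw : ∀ i, 0 < w i) (hS : 0 < S.card) :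
    optCost (S.val.map fun j => (p j).2) q ≤
      ENNReal.ofReal (70 * S.card * ∑ i, w i * r i ^ 2) := by
  have hne : ∀ i, ∃ j ∈ S, dist (p j).2 (μ i) ≤ 3 * r i := by
    intro i
    have h1 : (0 : ℝ) < (S.filter fun j => (p j).1 = i ∧ dist (p j).2 (μ i) ≤ 3 * r i).card := by
      refine lt_of_lt_of_le ?_ (h.le_card i)
      have := hw i
      have : (0 : ℝ) < S.card := by exact_mod_cast hS
      positivity
    obtain ⟨j, hj⟩ := Finset.card_pos.1 (by exact_mod_cast h1)
    exact ⟨j, (Finset.mem_filter.1 hj).1, (Finset.mem_filter.1 hj).2.2⟩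
  choose f hfS hf using hne
  set T : Finset E := Finset.univ.image fun i => (p (f i)).2
  have hT : T.Nonempty := ⟨_, Finset.mem_image_of_mem _ (Finset.mem_univ ⟨0, hk⟩)⟩
  refine (iInf₂_le T (⟨?_, ?_⟩ : (∀ y ∈ T, y ∈ S.val.map fun j => (p j).2) ∧ T.card ≤ q)).trans ?_
  · intro y hy
    obtain ⟨i, -, rfl⟩ := Finset.mem_image.1 hy
    exact Multiset.mem_map_of_mem _ (hfS i)
  · exact (Finset.card_image_le.trans (by simp)).trans hkq
  rw [cost_map_eq_ofReal hT]
  refine ENNReal.ofReal_le_ofReal ?_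
  rw [sum_eq_sum_label S p, Finset.mul_sum]
  refine Finset.sum_le_sum fun i _ => ?_
  -- The constant is `70 = 2 * 8 + 3 * 18`.
  calc _ ≤ ∑ j ∈ S.filter (fun j => (p j).1 = i), (2 * dist (p j).2 (μ i) ^ 2 + 18 * r i ^ 2) :=
        Finset.sum_le_sum fun j _ => infDist_sq_le_of_dist_le _ _
          (Finset.mem_image_of_mem _ (Finset.mem_univ i)) (hf i)
    _ = 2 * ∑ j ∈ S.filter (fun j => (p j).1 = i), dist (p j).2 (μ i) ^ 2 +
        (S.filter fun j => (p j).1 = i).card * (18 * r i ^ 2) := by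
        rw [Finset.sum_add_distrib, ← Finset.mul_sum, Finset.sum_const, nsmul_eq_mul]
    _ ≤ 2 * (8 * w i * S.card * r i ^ 2) + 3 * w i * S.card * (18 * r i ^ 2) := by
        gcongr
        · exact h.sum_filter_le i
        · exact h.card_le i
    _ = _ := by ring

/-- Centers that are good for a typical sample are close to the centers of the components. -/
theorem IsTypical.sum_infDist_sq_le {β : ℝ} (h : IsTypical w μ r S p) (hβ : 1 ≤ β)
    (hw : ∀ i, 0 < w i) (hS : 0 < S.card)
    (hcost : ∑ j ∈ S, Metric.infDist (p j).2 (T : Set E) ^ 2 ≤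
      β * (70 * S.card * ∑ i, w i * r i ^ 2)) :
    ∑ i, w i * Metric.infDist (μ i) (T : Set E) ^ 2 ≤ 776 * β * ∑ i, w i * r i ^ 2 := by
  have hs : (0 : ℝ) < S.card := by exact_mod_cast hS
  have hi : ∀ i, S.card / 4 * (w i * Metric.infDist (μ i) (T : Set E) ^ 2) ≤
      2 * ∑ j ∈ S.filter (fun j => (p j).1 = i), Metric.infDist (p j).2 (T : Set E) ^ 2 +
        54 * S.card * (w i * r i ^ 2) := by
    intro i
    set G := S.filter fun j => (p j).1 = i ∧ dist (p j).2 (μ i) ≤ 3 * r i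
    have hsub : G ⊆ S.filter fun j => (p j).1 = i := fun j hj =>
      Finset.mem_filter.2 ⟨(Finset.mem_filter.1 hj).1, (Finset.mem_filter.1 hj).2.1⟩
    have h1 : ∀ j ∈ G, Metric.infDist (μ i) (T : Set E) ^ 2 ≤
        2 * Metric.infDist (p j).2 (T : Set E) ^ 2 + 18 * r i ^ 2 := by
      intro j hj
      have h2 : Metric.infDist (μ i) (T : Set E) ≤ Metric.infDist (p j).2 (T : Set E) + 3 * r i :=
        Metric.infDist_le_infDist_add_dist.trans (add_le_add le_rfl
          ((dist_comm _ _).trans_le (Finset.mem_filter.1 hj).2.2))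
      have h3 := pow_le_pow_left₀ Metric.infDist_nonneg h2 2
      nlinarith [sq_nonneg (Metric.infDist (p j).2 (T : Set E) - 3 * r i)]
    calc _ = w i * S.card / 4 * Metric.infDist (μ i) (T : Set E) ^ 2 := by ring
      _ ≤ G.card * Metric.infDist (μ i) (T : Set E) ^ 2 := by
          gcongr
          exact h.le_card i
      _ ≤ ∑ j ∈ G, (2 * Metric.infDist (p j).2 (T : Set E) ^ 2 + 18 * r i ^ 2) := by
          rw [← nsmul_eq_mul]
          exact Finset.card_nsmul_le_sum _ _ _ h1
      _ ≤ ∑ j ∈ S.filter (fun j => (p j).1 = i),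
          (2 * Metric.infDist (p j).2 (T : Set E) ^ 2 + 18 * r i ^ 2) :=
          Finset.sum_le_sum_of_subset_of_nonneg hsub fun j _ _ => by positivity
      _ = 2 * ∑ j ∈ S.filter (fun j => (p j).1 = i), Metric.infDist (p j).2 (T : Set E) ^ 2 +
          (S.filter fun j => (p j).1 = i).card * (18 * r i ^ 2) := by
          rw [Finset.sum_add_distrib, ← Finset.mul_sum, Finset.sum_const, nsmul_eq_mul]
      _ ≤ 2 * ∑ j ∈ S.filter (fun j => (p j).1 = i), Metric.infDist (p j).2 (T : Set E) ^ 2 +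
          3 * w i * S.card * (18 * r i ^ 2) := by
          gcongr
          exact h.card_le i
      _ = _ := by ring
  have hsum := Finset.sum_le_sum fun i (_ : i ∈ Finset.univ) => hi i
  rw [← Finset.mul_sum, Finset.sum_add_distrib, ← Finset.mul_sum, ← Finset.mul_sum,
    ← sum_eq_sum_label S p] at hsum
  have hΦ : 0 ≤ ∑ i, w i * r i ^ 2 :=
    Finset.sum_nonneg fun i _ => mul_nonneg (hw i).le (sq_nonneg _)
  set Φ := ∑ i, w i * r i ^ 2
  -- Multiplying by 4 gives `560 * β + 216`, which is at most `776 * β` because `β ≥ 1`.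
  have h2 : S.card / 4 * ∑ i, w i * Metric.infDist (μ i) (T : Set E) ^ 2 ≤
      S.card / 4 * (776 * β * Φ) := by
    nlinarith [mul_nonneg hs.le hΦ, mul_nonneg (mul_nonneg hs.le hΦ) (sub_nonneg.2 hβ)]
  exact le_of_mul_le_mul_left h2 (by positivity)

/-- The cost on a typical sample in terms of the distances from the centers of the components. -/
theorem IsTypical.sum_infDist_sq_le_add (h : IsTypical w μ r S p) (T : Finset E) :
    ∑ j ∈ S, Metric.infDist (p j).2 (T : Set E) ^ 2 ≤
      S.card * (6 * ∑ i, w i * Metric.infDist (μ i) (T : Set E) ^ 2 +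
        16 * ∑ i, w i * r i ^ 2) := by
  rw [sum_eq_sum_label S p, Finset.mul_sum, Finset.mul_sum, ← Finset.sum_add_distrib,
    Finset.mul_sum]
  refine Finset.sum_le_sum fun i _ => ?_
  have h1 : ∀ j, Metric.infDist (p j).2 (T : Set E) ^ 2 ≤
      2 * dist (p j).2 (μ i) ^ 2 + 2 * Metric.infDist (μ i) (T : Set E) ^ 2 := by
    intro j
    have h2 : Metric.infDist (p j).2 (T : Set E) ≤
        Metric.infDist (μ i) (T : Set E) + dist (p j).2 (μ i) :=
      Metric.infDist_le_infDist_add_dist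
    have h3 := pow_le_pow_left₀ Metric.infDist_nonneg h2 2
    nlinarith [sq_nonneg (Metric.infDist (μ i) (T : Set E) - dist (p j).2 (μ i))]
  calc _ ≤ ∑ j ∈ S.filter (fun j => (p j).1 = i),
        (2 * dist (p j).2 (μ i) ^ 2 + 2 * Metric.infDist (μ i) (T : Set E) ^ 2) :=
        Finset.sum_le_sum fun j _ => h1 j
    _ = 2 * ∑ j ∈ S.filter (fun j => (p j).1 = i), dist (p j).2 (μ i) ^ 2 +
        (S.filter fun j => (p j).1 = i).card * (2 * Metric.infDist (μ i) (T : Set E) ^ 2) := by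
        rw [Finset.sum_add_distrib, ← Finset.mul_sum, Finset.sum_const, nsmul_eq_mul]
    _ ≤ 2 * (8 * w i * S.card * r i ^ 2) +
        3 * w i * S.card * (2 * Metric.infDist (μ i) (T : Set E) ^ 2) := by
        gcongr
        · exact h.sum_filter_le i
        · exact h.card_le i
    _ = _ := by ring

/-- The truncated cost on a typical and separated sample exceeds the squared distance of every point
that is not too far from the center of its component. -/
theorem IsSeparated.infDist_sq_le_truncCost {q l : ℕ} (hs : IsSeparated w r q S U p)
    (h : IsTypical w μ r S p) (hJU : J ⊆ U) (hJq : J.card ≤ q) (hJ : J.Nonempty)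
    (i : Fin k) (hr : 0 < r i) (hq : (q : ℝ) ≤ w i * S.card / 16)
    (hl : (l : ℝ) ≤ w i * S.card / 64) {g b : ℝ} (hg : 0 ≤ g) (hb : 0 ≤ b)
    (hgb : 512 * (18 + b) * g ≤ w i * S.card) (e : E) (he : dist e (μ i) ^ 2 ≤ b * r i ^ 2) :
    ENNReal.ofReal (g * Metric.infDist e (J.image fun j => (p j).2 : Finset E) ^ 2) ≤
      truncCost l (S.val.map fun j => (p j).2) (J.image fun j => (p j).2) := by
  set T := J.image fun j => (p j).2
  have hT : T.Nonempty := by simpa [T] using hJ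
  set D := Metric.infDist (μ i) (T : Set E)
  -- `A` bounds from below the distance to the centers for every point within `3 * r i` of `μ i`. It
  -- controls the case of a mean far from all centers; the scale `r i` itself, through separation,
  -- controls the other case.
  set A := max (D - 3 * r i) 0 with hA
  have hA0 : 0 ≤ A := le_max_right _ _
  have h1 : ENNReal.ofReal (w i * S.card / 8 * A ^ 2) ≤
      truncCost l (S.val.map fun j => (p j).2) T := by
    refine le_trans (ENNReal.ofReal_le_ofReal ?_) (le_truncCost_map hT (G := S.filter fun j =>
      (p j).1 = i ∧ dist (p j).2 (μ i) ≤ 3 * r i) (Finset.filter_subset _ _)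
      (fun j => (p j).2) l (a := A ^ 2) (sq_nonneg _) fun j hj => ?_)
    · refine mul_le_mul_of_nonneg_right ?_ (sq_nonneg _)
      have : (0 : ℝ) ≤ l := Nat.cast_nonneg _
      linarith [h.le_card i]
    · refine pow_le_pow_left₀ hA0 (max_le ?_ Metric.infDist_nonneg) 2
      have h2 : D ≤ Metric.infDist (p j).2 (T : Set E) + 3 * r i :=
        Metric.infDist_le_infDist_add_dist.trans (add_le_add le_rfl
          ((dist_comm _ _).trans_le (Finset.mem_filter.1 hj).2.2))
      linarith
  have h2 : ENNReal.ofReal (w i * S.card / 128 * r i ^ 2) ≤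
      truncCost l (S.val.map fun j => (p j).2) T := by
    refine le_trans (ENNReal.ofReal_le_ofReal ?_) (le_truncCost_map hT (G := S.filter fun j =>
      (p j).1 = i ∧ r i / 2 ≤ Metric.infDist (p j).2 (T : Set E)) (Finset.filter_subset _ _)
      (fun j => (p j).2) l (a := (r i / 2) ^ 2) (sq_nonneg _) fun j hj => ?_)
    · have h3 := hs.le_card_far h hJU hJq hJ i
      have : (0 : ℝ) ≤ l := Nat.cast_nonneg _
      calc w i * S.card / 128 * r i ^ 2 = w i * S.card / 32 * (r i / 2) ^ 2 := by ring
        _ ≤ _ := mul_le_mul_of_nonneg_right (by linarith) (sq_nonneg _)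
    · exact pow_le_pow_left₀ (by positivity) (Finset.mem_filter.1 hj).2.2 2
  have h3 : Metric.infDist e (T : Set E) ^ 2 ≤ 4 * A ^ 2 + (36 + 2 * b) * r i ^ 2 := by
    have h4 : Metric.infDist e (T : Set E) ≤ (A + 3 * r i) + dist e (μ i) :=
      Metric.infDist_le_infDist_add_dist.trans (add_le_add
        (by linarith [le_max_left (D - 3 * r i) 0]) le_rfl)
    have h5 := pow_le_pow_left₀ Metric.infDist_nonneg h4 2
    nlinarith [sq_nonneg (A + 3 * r i - dist e (μ i)), sq_nonneg (A - 3 * r i)]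
  have hbg : 0 ≤ b * g := mul_nonneg hb hg
  -- The larger of the two lower bounds controls both `A ^ 2` and `r i ^ 2`, hence the upper bound
  -- `h3`; the constant 512 leaves slack in both cases.
  rcases le_total (w i * S.card / 8 * A ^ 2) (w i * S.card / 128 * r i ^ 2) with hle | hle
  · refine (ENNReal.ofReal_le_ofReal ?_).trans h2
    nlinarith [mul_le_mul_of_nonneg_left h3 hg, sq_nonneg A, sq_nonneg (r i),
      mul_le_mul_of_nonneg_right hgb (sq_nonneg A),
      mul_le_mul_of_nonneg_right hgb (sq_nonneg (r i)),
      mul_nonneg hg (sq_nonneg A), mul_nonneg hbg (sq_nonneg A)]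
  · refine (ENNReal.ofReal_le_ofReal ?_).trans h1
    nlinarith [mul_le_mul_of_nonneg_left h3 hg, sq_nonneg A, sq_nonneg (r i),
      mul_le_mul_of_nonneg_right hgb (sq_nonneg A),
      mul_le_mul_of_nonneg_right hgb (sq_nonneg (r i)),
      mul_nonneg hg (sq_nonneg A), mul_nonneg hbg (sq_nonneg A)]

end TypicalCost

/-! ### Runs of the algorithm -/

namespace Input

variable {E : Type*} [MetricSpace E] {n m : ℕ} (I : Input E n m)

/-- The indices of the points that join the sub-sample `l` in the first round. -/
def firstSample (α : ℝ) (c : Coins n) (l : Fin 2) : Finset (Fin n) :=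
  Finset.univ.filter fun i => (c (0, l, i) : ℝ) ≤ α

theorem total_data_zero (c : Coins n) : total (I.data c 0) = n := by
  have h := Finset.card_eq_sum_card_fiberwise (f := I.machine) (s := Finset.univ)
    (t := Finset.univ) fun i _ => Finset.mem_coe.2 (Finset.mem_univ _)
  rw [Finset.card_univ, Fintype.card_fin] at h
  exact h.symm

theorem biUnion_data_zero (c : Coins n) :
    Finset.univ.biUnion (I.data c 0) = Finset.univ := by
  ext i
  simp [data]

/-- The partition among the machines drops out: in the first round the sub-samples depend on the
coins only, so they are independent of the data even if the partition is not. -/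
theorem sample_zero (c : Coins n) (l : Fin 2) :
    I.sample c 0 (I.data c 0) l = firstSample (eta I.δ I.ε I.k n / n) c l := by
  have hα : I.alpha (I.data c 0) = eta I.δ I.ε I.k n / n := by rw [alpha, total_data_zero]
  ext i
  simp only [sample, machineSample, hα, firstSample, Finset.mem_biUnion, Finset.mem_filter,
    Finset.mem_univ, true_and]
  simp [data]

/-- If the coordinator can hold all points, the loop is not entered. -/
theorem stopsAfter_zero (c : Coins n) (h : (n : ℝ) ≤ eta I.δ I.ε I.k n) :
    I.StopsAfter c 0 :=
  ⟨fun t ht => absurd ht (Nat.not_lt_zero t), by rwa [total_data_zero]⟩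

theorem cost_output_zero_le {β : ℝ} (hA : IsApproxAlgorithm β I.A) (c : Coins n) :
    cost (Finset.univ.val.map I.x) (I.output c 0) ≤
      ENNReal.ofReal β * optCost (Finset.univ.val.map I.x) I.k := by
  have h : I.output c 0 = I.A (Finset.univ.val.map I.x) I.k := by
    simp only [output, Finset.range_zero, Finset.biUnion_empty, Finset.empty_union,
      biUnion_data_zero, points]
  rw [h]
  exact hA.cost_le _ _

/-- If the centers of the first round are within the threshold of every point, the algorithm
stops after this round and outputs these centers. -/
theorem stopsAfter_one_and_output {β : ℝ} (hA : IsApproxAlgorithm β I.A) (c : Coins n)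
    (hη0 : 0 ≤ eta I.δ I.ε I.k n) (hη : eta I.δ I.ε I.k n < n)
    (h : ∀ i, Metric.infEDist (I.x i) (I.iterCenters c 0 (I.data c 0) : Set E) ^ 2 ≤
      I.threshold c 0 (I.data c 0)) :
    I.StopsAfter c 1 ∧ I.output c 1 = I.iterCenters c 0 (I.data c 0) := by
  have hdata : ∀ j, I.data c 1 j = ∅ := by
    intro j
    refine Finset.eq_empty_of_forall_notMem fun i hi => ?_
    exact (Finset.mem_filter.1 hi).2.not_ge (h i)
  refine ⟨⟨fun t ht => ?_, ?_⟩, ?_⟩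
  · obtain rfl : t = 0 := by omega
    rwa [total_data_zero]
  · simpa [total, hdata] using hη0
  · have hV : Finset.univ.biUnion (I.data c 1) = ∅ := by
      ext i
      simp [hdata]
    -- Centers must be points of the input, so an empty remainder contributes none.
    have hAV : I.A (I.points ∅) I.k = ∅ := by
      refine Finset.eq_empty_of_forall_notMem fun y hy => ?_
      simpa [points] using hA.subset _ _ y hy
    simp only [output, hV, hAV, Finset.range_one, Finset.singleton_biUnion, Finset.union_empty]

/-- On typical and separated data the algorithm stops after one round, with a good output. -/
theorem stopsAfter_one_of_isTypical {β : ℝ} (hβ : 1 ≤ β) (hA : IsApproxAlgorithm β I.A)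
    (c : Coins n) (hη0 : 0 ≤ eta I.δ I.ε I.k n) (hη : eta I.δ I.ε I.k n < n) (hk : 0 < I.k)
    (hkq : I.k ≤ kPlus I.δ I.ε I.k) (hdK : 0 < dK I.δ I.ε I.k)
    {w r : Fin I.k → ℝ} {μ : Fin I.k → E} (hw : ∀ i, 0 < w i) (hr : ∀ i, 0 < r i)
    {lab : Fin n → Fin I.k} {P₁ P₂ : Finset (Fin n)} {b : ℝ} (hb : 0 ≤ b)
    (hP₁ : firstSample (eta I.δ I.ε I.k n / n) c 0 = P₁)
    (hP₂ : firstSample (eta I.δ I.ε I.k n / n) c 1 = P₂)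
    (hP₁c : 0 < P₁.card)
    (ht : IsTypical w μ r Finset.univ fun j => (lab j, I.x j))
    (ht₁ : IsTypical w μ r P₁ fun j => (lab j, I.x j))
    (ht₂ : IsTypical w μ r P₂ fun j => (lab j, I.x j))
    (hs : IsSeparated w r (kPlus I.δ I.ε I.k) Finset.univ Finset.univ fun j => (lab j, I.x j))
    (hs₂ : IsSeparated w r (kPlus I.δ I.ε I.k) P₂ P₁ fun j => (lab j, I.x j))
    (hx : ∀ j, dist (I.x j) (μ (lab j)) ^ 2 ≤ b * r (lab j) ^ 2)
    (hq : ∀ i, (kPlus I.δ I.ε I.k : ℝ) ≤ w i * n / 16)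
    (hq₂ : ∀ i, (kPlus I.δ I.ε I.k : ℝ) ≤ w i * P₂.card / 16)
    (hl : ∀ i, (truncNum I.δ I.ε I.k : ℝ) ≤ w i * P₂.card / 64)
    (hg : ∀ i, 512 * (18 + b) * (3 * I.k * dK I.δ I.ε I.k / 2) ≤ w i * P₂.card) :
    I.StopsAfter c 1 ∧ cost (Finset.univ.val.map I.x) (I.output c 1) ≤
      ENNReal.ofReal (299008 * β) * optCost (Finset.univ.val.map I.x) I.k := by
  classical
  set C := I.iterCenters c 0 (I.data c 0) with hCdef
  have hC : C = I.A (P₁.val.map I.x) (kPlus I.δ I.ε I.k) := by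
    rw [hCdef, iterCenters, sample_zero, hP₁, points]
  have hcost : cost (P₁.val.map I.x) C ≤
      ENNReal.ofReal (β * (70 * P₁.card * ∑ i, w i * r i ^ 2)) := by
    rw [hC, ENNReal.ofReal_mul (by linarith)]
    exact (hA.cost_le _ _).trans (mul_le_mul_right (ht₁.optCost_le hk hkq hw hP₁c) _)
  have hCne : C.Nonempty := by
    by_contra hcon
    rw [Finset.not_nonempty_iff_eq_empty.1 hcon, cost_map_empty (Finset.card_pos.1 hP₁c)] at hcost
    exact ENNReal.ofReal_ne_top (top_le_iff.1 hcost)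
  obtain ⟨J, hJ, hJcard, hJC⟩ := exists_index_set (S := P₁) (x := I.x) (T := C)
    (by rw [hC]; exact hA.subset _ _)
  have hJq : J.card ≤ kPlus I.δ I.ε I.k := hJcard.trans (by rw [hC]; exact hA.card_le _ _)
  -- The centers cannot be empty: the cost of the empty set on the nonempty `P₁` is infinite, while
  -- the approximation guarantee is finite.
  have hJne : J.Nonempty := by
    rw [← hJC] at hCne
    simpa using hCne
  have hk' : (0 : ℝ) < I.k := by exact_mod_cast hk
  have hthr : ∀ i, Metric.infEDist (I.x i) (C : Set E) ^ 2 ≤ I.threshold c 0 (I.data c 0) := by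
    intro j
    have h := hs₂.infDist_sq_le_truncCost ht₂ hJ hJq hJne (lab j) (hr _) (hq₂ _) (hl _)
      -- This `g` is the reciprocal of the factor of the truncated cost in the threshold, so the
      -- conclusion is exactly `ρ² ≤ v`.
      (g := 3 * I.k * dK I.δ I.ε I.k / 2) (by positivity) hb (hg _) (I.x j) (hx j)
    simp only at h
    rw [hJC] at h
    rw [infEDist_sq_eq_ofReal hCne, threshold, sample_zero, hP₂, points, ← hCdef,
      ENNReal.le_div_iff_mul_le (Or.inl (ENNReal.ofReal_pos.2 (by positivity)).ne')
        (Or.inl ENNReal.ofReal_ne_top),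
      ← ENNReal.ofReal_mul (sq_nonneg _)]
    calc _ = 2 * ENNReal.ofReal (3 * I.k * dK I.δ I.ε I.k / 2 *
          Metric.infDist (I.x j) (C : Set E) ^ 2) := by
          rw [← ENNReal.ofReal_ofNat 2, ← ENNReal.ofReal_mul (by norm_num)]
          congr 1
          ring
      _ ≤ _ := mul_le_mul_right h _
  obtain ⟨hrun, hout⟩ := I.stopsAfter_one_and_output hA c hη0 hη hthr
  refine ⟨hrun, ?_⟩
  have hΦ : 0 ≤ ∑ i, w i * r i ^ 2 :=
    Finset.sum_nonneg fun i _ => mul_nonneg (hw i).le (sq_nonneg _)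
  rw [cost_map_eq_ofReal hCne] at hcost
  have hD := ht₁.sum_infDist_sq_le hβ hw hP₁c
    ((ENNReal.ofReal_le_ofReal_iff (by positivity)).1 hcost)
  have hopt := hs.le_optCost ht hkq (by simpa using hq)
  have hX := ht.sum_infDist_sq_le_add C
  rw [hout, ← hCdef, cost_map_eq_ofReal hCne]
  refine le_trans ?_ (mul_le_mul_right hopt _)
  rw [← ENNReal.ofReal_mul (by linarith)]
  refine ENNReal.ofReal_le_ofReal (hX.trans ?_)
  have hn : (0 : ℝ) ≤ (Finset.univ : Finset (Fin n)).card := Nat.cast_nonneg _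
  -- The final factor is `299008 = 64 * (6 * 776 + 16)`, with `β ≥ 1` absorbing the term without
  -- `β`.
  nlinarith [mul_le_mul_of_nonneg_left hD hn, mul_nonneg hn hΦ,
    mul_nonneg (mul_nonneg hn hΦ) (sub_nonneg.2 hβ)]

end Input

/-! ### The sizes of the samples -/

section Samples

variable {n : ℕ}

/-- The law of the random numbers used by the algorithm. -/
def coinLaw (n : ℕ) : Measure (Coins n) :=
  Measure.infinitePi fun _ : ℕ × Fin 2 × Fin n => (volume : Measure unitInterval)

instance : IsProbabilityMeasure (coinLaw n) := by
  unfold coinLaw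
  infer_instance

theorem measurableSet_unitInterval_le (α : ℝ) :
    MeasurableSet {u : unitInterval | (u : ℝ) ≤ α} :=
  measurableSet_le measurable_subtype_coe measurable_const

theorem measurableSet_firstSample_eq (α : ℝ) (l : Fin 2) (Q : Finset (Fin n)) :
    MeasurableSet {c : Coins n | Input.firstSample α c l = Q} := by
  have h : {c : Coins n | Input.firstSample α c l = Q} =
      ⋂ i, {c : Coins n | (c (0, l, i) : ℝ) ≤ α ↔ i ∈ Q} := by
    ext c
    simp [Input.firstSample, Finset.ext_iff]
  rw [h]
  refine MeasurableSet.iInter fun i => ?_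
  have h1 : MeasurableSet {c : Coins n | (c (0, l, i) : ℝ) ≤ α} :=
    measurableSet_preimage (f := fun c : Coins n => c (0, l, i)) (measurable_pi_apply _)
      (measurableSet_unitInterval_le α)
  by_cases hi : i ∈ Q
  · simpa only [hi, iff_true] using h1
  · simp only [hi, iff_false]
    exact h1.compl

/-- Chernoff's bound for the binomial size of a sub-sample. The sign of `t` selects the tail:
positive for too many points, negative for too few. -/
theorem coinLaw_le_sum_indicator_le {α t p : ℝ} (hα0 : 0 ≤ α) (hα1 : α ≤ 1) (l : Fin 2)
    (h : α * (Real.exp t - 1) ≤ p) (s : ℝ) :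
    coinLaw n {c | s ≤ t * (Input.firstSample α c l).card} ≤
      ENNReal.ofReal (Real.exp (n * p - s)) := by
  classical
  set A := {u : unitInterval | (u : ℝ) ≤ α} with hA
  have hvol : (volume : Measure unitInterval).real A = α := by
    have : A = Set.Iic ⟨α, hα0, hα1⟩ := by
      ext u
      rfl
    rw [this, measureReal_def, unitInterval.volume_Iic]
    simp [hα0]
  have hm : Measurable (A.indicator fun _ => t) :=
    measurable_const.indicator (measurableSet_unitInterval_le α)
  have hind : iIndepFun (fun (i : Fin n) (c : Coins n) =>
      A.indicator (fun _ => t) (c (0, l, i))) (coinLaw n) :=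
    (iIndepFun_infinitePi (P := fun _ : ℕ × Fin 2 × Fin n => (volume : Measure unitInterval))
      (X := fun _ => A.indicator fun _ => t) fun _ => hm).precomp
      (g := fun i : Fin n => ((0 : ℕ), l, i)) fun i j hij => by simpa using hij
  have hC := measure_le_sum_le_exp hind (fun i => hm.comp (measurable_pi_apply _)) Finset.univ
    (b := p) (fun i _ => ((measurePreserving_eval_infinitePi
      (fun _ : ℕ × Fin 2 × Fin n => (volume : Measure unitInterval)) (0, l, i)).lintegral_comp
      (Real.measurable_exp.comp hm).ennreal_ofReal).trans_le
      (lintegral_exp_indicator_le _ (measurableSet_unitInterval_le α) (by rwa [hvol]))) s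
  refine (measure_mono fun c hc => ?_).trans (hC.trans (by simp))
  simp only [Set.mem_ofPred_eq] at hc ⊢
  rw [sum_indicator_eq Finset.univ A t fun i => c (0, l, i)]
  refine hc.trans (le_of_eq ?_)
  simp [Input.firstSample, hA]

/-- The mean size is `η`. Taking `t = 1` gives exponent `2η - 3η` for the upper tail, and `t = -1`
gives `-(6/10)η + η/2 = -η/10` for the lower one. -/
theorem coinLaw_card_firstSample {η : ℝ} (hη0 : 0 ≤ η) (hηn : η < n) (l : Fin 2) :
    coinLaw n {c | ¬ (η / 2 ≤ (Input.firstSample (η / n) c l).card ∧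
      ((Input.firstSample (η / n) c l).card : ℝ) ≤ 3 * η)} ≤
      ENNReal.ofReal (2 * Real.exp (-(η / 10))) := by
  have hn : (0 : ℝ) < n := hη0.trans_lt hηn
  have hα0 : 0 ≤ η / n := by positivity
  have hα1 : η / n ≤ 1 := (div_le_one hn).2 hηn.le
  have hup := coinLaw_le_sum_indicator_le (n := n) hα0 hα1 l (t := 1) (p := η / n * 2)
    (mul_le_mul_of_nonneg_left (by linarith [Real.exp_one_lt_d9]) hα0) (3 * η)
  have hlo := coinLaw_le_sum_indicator_le (n := n) hα0 hα1 l (t := -1) (p := η / n * -(6 / 10))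
    (mul_le_mul_of_nonneg_left (by linarith [Real.exp_neg_one_lt_d9]) hα0) (-(η / 2))
  have h1 : n * (η / n * 2) - 3 * η ≤ -(η / 10) := by
    rw [← mul_assoc, mul_div_cancel₀ _ hn.ne']
    linarith
  have h2 : n * (η / n * -(6 / 10)) - -(η / 2) ≤ -(η / 10) := by
    rw [← mul_assoc, mul_div_cancel₀ _ hn.ne']
    linarith
  rw [two_mul, ENNReal.ofReal_add (Real.exp_nonneg _) (Real.exp_nonneg _)]
  refine (measure_mono fun c hc => ?_).trans ((measure_union_le _ _).trans (add_le_add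
    (hup.trans (ENNReal.ofReal_le_ofReal (Real.exp_le_exp.2 h1)))
    (hlo.trans (ENNReal.ofReal_le_ofReal (Real.exp_le_exp.2 h2)))))
  simp only [Set.mem_union, Set.mem_ofPred_eq, not_and_or, not_le] at hc ⊢
  rcases hc with hc | hc
  · right
    linarith
  · left
    linarith

end Samples

/-! ### Combining the coins with the data, and removing the labels -/

/-- A bound for an event that depends on a first random variable and on a second, independent,
random variable with finitely many values. -/
theorem prod_le_of_forall_value {X Y F : Type*} [MeasurableSpace X] [MeasurableSpace Y] [Fintype F]
    (ν : Measure X) (κ : Measure Y) [SFinite ν] [IsProbabilityMeasure κ] {Q : Y → F}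
    (hQ : ∀ f, MeasurableSet {c | Q c = f}) (G : F → Prop) (B : F → Set X) {b : ℝ≥0∞}
    (h : ∀ f, G f → ν (B f) ≤ b) :
    ν.prod κ {p | G (Q p.2) ∧ p.1 ∈ B (Q p.2)} ≤ b := by
  classical
  have hsub : {p : X × Y | G (Q p.2) ∧ p.1 ∈ B (Q p.2)} ⊆
      ⋃ f ∈ Finset.univ.filter G, B f ×ˢ {c | Q c = f} := by
    rintro ⟨x, c⟩ ⟨hG, hx⟩
    simp only [Set.mem_iUnion]
    exact ⟨Q c, Finset.mem_filter.2 ⟨Finset.mem_univ _, hG⟩, hx, rfl⟩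
  refine (measure_mono hsub).trans ((measure_biUnion_finset_le _ _).trans ?_)
  calc _ ≤ ∑ f ∈ Finset.univ.filter G, b * κ {c | Q c = f} := by
        refine Finset.sum_le_sum fun f hf => ?_
        rw [Measure.prod_prod]
        exact mul_le_mul_left (h f (Finset.mem_filter.1 hf).2) _
    -- The events for different values are disjoint, so there is no loss from the number of values.
    _ = b * κ (⋃ f ∈ Finset.univ.filter G, {c | Q c = f}) := by
        rw [← Finset.mul_sum, measure_biUnion_finset _ fun f _ => hQ f]
        intro f _ g _ hfg
        exact Set.disjoint_left.2 fun c hc hc' => hfg (hc.symm.trans hc')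
    _ ≤ b := mul_le_of_le_one_right' prob_le_one

/-- A bound for an event of samples from a mixture that follows from one for labelled samples. -/
theorem pi_forall_label_le {E ι : Type*} [MeasurableSpace E] [Fintype ι] {k : ℕ} {w : Fin k → ℝ}
    {N : Fin k → Measure E} [IsProbabilityMeasure (labelledMixture w N)]
    {B : Set (ι → Fin k × E)} (hB : MeasurableSet B) :
    (Measure.pi fun _ : ι => ∑ i, ENNReal.ofReal (w i) • N i)
      {x | ∀ lab : ι → Fin k, (fun j => (lab j, x j)) ∈ B} ≤
      (Measure.pi fun _ : ι => labelledMixture w N) B := by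
  have hm : MeasurableSet {x : ι → E | ∀ lab : ι → Fin k, (fun j => (lab j, x j)) ∈ B} := by
    have : {x : ι → E | ∀ lab : ι → Fin k, (fun j => (lab j, x j)) ∈ B} =
        ⋂ lab : ι → Fin k, (fun x j => (lab j, x j)) ⁻¹' B := by
      ext x
      simp
    rw [this]
    exact MeasurableSet.iInter fun lab => measurableSet_preimage (by fun_prop) hB
  have : IsProbabilityMeasure ((labelledMixture w N).map Prod.snd) :=
    Measure.isProbabilityMeasure_map measurable_snd.aemeasurable
  have hmap := Measure.pi_map_pi (μ := fun _ : ι => labelledMixture w N) (f := fun _ => Prod.snd)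
    fun _ => measurable_snd.aemeasurable
  simp_rw [map_snd_labelledMixture] at hmap
  rw [← hmap, Measure.map_apply (by fun_prop) hm]
  -- The true labels are one of the labellings, so if every labelling of the points is bad, the
  -- labelled sample is bad.
  exact measure_mono fun p hp => hp fun j => (p j).1

/-! ### Good labelled samples from a spherical Gaussian mixture -/

section Gaussian

variable {d k n : ℕ}

/-- The spherical Gaussian with mean `μ` and covariance matrix `σ² I`. -/
abbrev sphericalGaussian (μ : EuclideanSpace ℝ (Fin d)) (σ : ℝ) :
    Measure (EuclideanSpace ℝ (Fin d)) :=
  multivariateGaussian μ (σ ^ 2 • (1 : Matrix (Fin d) (Fin d) ℝ))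

/-- The events on labelled data points under which the algorithm with the sub-samples `P₁`, `P₂`
succeeds. -/
structure IsGoodSample (w : Fin k → ℝ) (μ : Fin k → EuclideanSpace ℝ (Fin d))
    (r : Fin k → ℝ) (q : ℕ) (b : ℝ)
    (P₁ P₂ : Finset (Fin n)) (p : Fin n → Fin k × EuclideanSpace ℝ (Fin d)) : Prop where
  typical : IsTypical w μ r Finset.univ p
  typical_fst : IsTypical w μ r P₁ p
  typical_snd : IsTypical w μ r P₂ p
  separated : IsSeparated w r q Finset.univ Finset.univ p
  separated_snd : IsSeparated w r q P₂ P₁ p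
  dist_sq_le : ∀ j, dist (p j).2 (μ (p j).1) ^ 2 ≤ b * r (p j).1 ^ 2

theorem measurable_dist_label (μ : Fin k → EuclideanSpace ℝ (Fin d)) :
    Measurable fun x : Fin k × EuclideanSpace ℝ (Fin d) => dist x.2 (μ x.1) :=
  measurable_snd.dist ((measurable_of_countable μ).comp measurable_fst)

theorem measurableSet_dist_label_le (μ : Fin k → EuclideanSpace ℝ (Fin d)) (r : Fin k → ℝ) (b : ℝ) :
    MeasurableSet {x : Fin k × EuclideanSpace ℝ (Fin d) | dist x.2 (μ x.1) ^ 2 ≤ b * r x.1 ^ 2} :=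
  measurableSet_le ((measurable_dist_label μ).pow_const 2)
    ((measurable_of_countable fun i => b * r i ^ 2).comp measurable_fst)

theorem measurableSet_isGoodSample (w : Fin k → ℝ) (μ : Fin k → EuclideanSpace ℝ (Fin d)) (r : Fin k → ℝ) (q : ℕ)
    (b : ℝ) (P₁ P₂ : Finset (Fin n)) :
    MeasurableSet {p : Fin n → Fin k × EuclideanSpace ℝ (Fin d) |
      IsGoodSample w μ r q b P₁ P₂ p} := by
  have h : {p : Fin n → Fin k × EuclideanSpace ℝ (Fin d) | IsGoodSample w μ r q b P₁ P₂ p} =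
      {p | IsTypical w μ r Finset.univ p} ∩ ({p | IsTypical w μ r P₁ p} ∩
        ({p | IsTypical w μ r P₂ p} ∩ ({p | IsSeparated w r q Finset.univ Finset.univ p} ∩
          ({p | IsSeparated w r q P₂ P₁ p} ∩
            ⋂ j, (fun p => p j) ⁻¹' {x | dist x.2 (μ x.1) ^ 2 ≤ b * r x.1 ^ 2})))) := by
    ext p
    simp only [Set.mem_ofPred_eq, Set.mem_inter_iff, Set.mem_iInter, Set.mem_preimage]
    exact ⟨fun ⟨h1, h2, h3, h4, h5, h6⟩ => ⟨h1, h2, h3, h4, h5, h6⟩,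
      fun ⟨h1, h2, h3, h4, h5, h6⟩ => ⟨h1, h2, h3, h4, h5, h6⟩⟩
  rw [h]
  exact (measurableSet_isTypical _ _ _ _).inter ((measurableSet_isTypical _ _ _ _).inter
    ((measurableSet_isTypical _ _ _ _).inter ((measurableSet_isSeparated _ _ _ _ _).inter
      ((measurableSet_isSeparated _ _ _ _ _).inter (MeasurableSet.iInter fun j =>
        measurableSet_preimage (measurable_pi_apply j) (measurableSet_dist_label_le μ r b))))))

variable {w : Fin k → ℝ} (μ : Fin k → EuclideanSpace ℝ (Fin d)) {σ : Fin k → ℝ}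

/-- All labelled points are within the expected distance of the centers of their components. -/
theorem pi_exists_lt_dist_sq_le (hw : ∀ i, 0 < w i) (hw1 : ∑ i, w i = 1) (hσ : ∀ i, 0 < σ i)
    (hd : 0 < d) (u : ℝ) :
    (Measure.pi fun _ : Fin n => labelledMixture w fun i => sphericalGaussian (μ i) (σ i))
      {p | ∃ j, 8 * (1 + u / d) * (σ (p j).1 * √d) ^ 2 < dist (p j).2 (μ (p j).1) ^ 2} ≤
      ENNReal.ofReal (n * Real.exp (-(2 * u))) := by
  have := isProbabilityMeasure_labelledMixture
    (N := fun i => sphericalGaussian (μ i) (σ i)) hw hw1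
  set P := labelledMixture w fun i => sphericalGaussian (μ i) (σ i)
  set A := {x : Fin k × EuclideanSpace ℝ (Fin d) |
    8 * (1 + u / d) * (σ x.1 * √d) ^ 2 < dist x.2 (μ x.1) ^ 2} with hA
  have hAm : MeasurableSet A := by
    have : A = {x | dist x.2 (μ x.1) ^ 2 ≤ 8 * (1 + u / d) * (σ x.1 * √d) ^ 2}ᶜ := by
      ext x
      simp [A]
    rw [this]
    exact (measurableSet_dist_label_le μ (fun i => σ i * √d) _).compl
  have hPA : P A ≤ ENNReal.ofReal (Real.exp (-(2 * u))) := by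
    have h1 : P A = ∑ i, ENNReal.ofReal (w i) *
        sphericalGaussian (μ i) (σ i) {x | 8 * σ i ^ 2 * (d + u) < dist x (μ i) ^ 2} := by
      simp only [P, labelledMixture, Measure.coe_finsetSum, Finset.sum_apply, Measure.smul_apply,
        smul_eq_mul]
      refine Finset.sum_congr rfl fun i _ => ?_
      rw [Measure.map_apply measurable_prodMk_left hAm]
      congr 2
      ext x
      have hd' : (d : ℝ) ≠ 0 := by positivity
      simp only [hA, Set.mem_preimage, Set.mem_ofPred_eq]
      rw [mul_pow, Real.sq_sqrt (by positivity)]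
      field_simp
    rw [h1]
    refine (Finset.sum_le_sum fun i _ => mul_le_mul_right
      (gaussian_dist_sq_ge_le (μ i) (hσ i) (u := u)) _).trans ?_
    rw [← Finset.sum_mul, sum_ofReal_weights hw hw1, one_mul]
  have hsub : {p : Fin n → Fin k × EuclideanSpace ℝ (Fin d) |
      ∃ j, 8 * (1 + u / d) * (σ (p j).1 * √d) ^ 2 <
      dist (p j).2 (μ (p j).1) ^ 2} ⊆ ⋃ j ∈ Finset.univ, (fun p => p j) ⁻¹' A := by
    rintro p ⟨j, hj⟩
    simp only [Set.mem_iUnion]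
    exact ⟨j, Finset.mem_univ _, hj⟩
  refine (measure_mono hsub).trans ((measure_biUnion_finset_le _ _).trans ?_)
  calc _ ≤ ∑ _j : Fin n, ENNReal.ofReal (Real.exp (-(2 * u))) := by
        refine Finset.sum_le_sum fun j _ => ?_
        exact ((measurePreserving_eval (fun _ : Fin n => P) j).measure_preimage
          hAm.nullMeasurableSet).trans_le hPA
    _ = _ := by
        rw [Finset.sum_const, Finset.card_univ, Fintype.card_fin, nsmul_eq_mul,
          ENNReal.ofReal_mul (by positivity), ENNReal.ofReal_natCast]

/-- A union bound over the six properties: three typicality events of `3k` terms each and two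
separation events of `k` terms give `11k`. All sets involved have at least `η / 2` points, which
turns `1/20` into `1/40`, and `|P₁| ≤ 3η ≤ 6 |P₂|` is the size condition for separation. -/
theorem pi_not_isGoodSample_le (hw : ∀ i, 0 < w i) (hw1 : ∑ i, w i = 1) (hσ : ∀ i, 0 < σ i)
    (hd : 0 < d) (u : ℝ) {ω : ℝ} (hω0 : 0 < ω) (hω : ∀ i, ω ≤ w i) (hω1 : ω ≤ 1) {q : ℕ}
    (hq : q * Real.exp (-(d / 6 : ℝ)) ≤ Real.exp (-(64 / ω))) {η : ℝ} (hηn : η ≤ n)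
    {P₁ P₂ : Finset (Fin n)} (h₁ : η / 2 ≤ P₁.card) (h₁' : P₁.card ≤ 3 * η)
    (h₂ : η / 2 ≤ P₂.card) :
    (Measure.pi fun _ : Fin n => labelledMixture w fun i => sphericalGaussian (μ i) (σ i))
      {p | ¬ IsGoodSample w μ (fun i => σ i * √d) q (8 * (1 + u / d)) P₁ P₂ p} ≤
      ENNReal.ofReal (11 * k * Real.exp (-(ω * η / 40)) + n * Real.exp (-(2 * u))) := by
  have hr : ∀ i, 0 < σ i * √d := fun i => mul_pos (hσ i) (by positivity)
  set X := Real.exp (-(ω * η / 40)) with hX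
  have ht : ∀ S : Finset (Fin n), η / 2 ≤ S.card →
      (Measure.pi fun _ : Fin n => labelledMixture w fun i => sphericalGaussian (μ i) (σ i))
      {p | ¬ IsTypical w μ (fun i => σ i * √d) S p} ≤ ENNReal.ofReal (3 * k * X) := by
    intro S hS
    refine (pi_not_isTypical_le hw hw1 hr (fun i => lintegral_exp_dist_sq_gaussian_le (μ i) (hσ i)
      hd) hω S).trans (ENNReal.ofReal_le_ofReal ?_)
    refine mul_le_mul_of_nonneg_left (Real.exp_le_exp.2 ?_) (by positivity)
    nlinarith
  have hs : ∀ S U : Finset (Fin n), η / 2 ≤ S.card → (U.card : ℝ) ≤ 6 * S.card →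
      (Measure.pi fun _ : Fin n => labelledMixture w fun i => sphericalGaussian (μ i) (σ i))
      {p | ¬ IsSeparated w (fun i => σ i * √d) q S U p} ≤ ENNReal.ofReal (k * X) := by
    intro S U hS hU
    refine (pi_not_isSeparated_le hw hw1 hω0 (Real.exp_nonneg _)
      (fun i c => gaussian_dist_lt_le (μ i) (hσ i) c) hω hq S U hU).trans
      (ENNReal.ofReal_le_ofReal ?_)
    refine mul_le_mul_of_nonneg_left (Real.exp_le_exp.2 ?_) (by positivity)
    nlinarith
  have hu : η / 2 ≤ (Finset.univ : Finset (Fin n)).card := by simp; linarith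
  have hX0 : 0 ≤ k * X := mul_nonneg (Nat.cast_nonneg _) (Real.exp_nonneg _)
  have hsum : ENNReal.ofReal (11 * k * X + n * Real.exp (-(2 * u))) =
      ENNReal.ofReal (3 * k * X) + (ENNReal.ofReal (3 * k * X) + (ENNReal.ofReal (3 * k * X) +
      (ENNReal.ofReal (k * X) + (ENNReal.ofReal (k * X) +
        ENNReal.ofReal (n * Real.exp (-(2 * u))))))) := by
    have hn0 : 0 ≤ n * Real.exp (-(2 * u)) := by positivity
    rw [← ENNReal.ofReal_add hX0 hn0, ← ENNReal.ofReal_add hX0 (by linarith),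
      ← ENNReal.ofReal_add (by linarith) (by linarith),
      ← ENNReal.ofReal_add (by linarith) (by linarith),
      ← ENNReal.ofReal_add (by linarith) (by linarith)]
    congr 1
    ring
  rw [hsum]
  refine (measure_mono fun p hp => ?_).trans ((measure_union_le _ _).trans (add_le_add (ht _ hu)
    ((measure_union_le _ _).trans (add_le_add (ht P₁ h₁)
    ((measure_union_le _ _).trans (add_le_add (ht P₂ h₂)
    ((measure_union_le _ _).trans (add_le_add (hs _ Finset.univ hu (by
      linarith [Nat.cast_nonneg (α := ℝ) (Finset.univ : Finset (Fin n)).card]))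
    ((measure_union_le _ _).trans (add_le_add (hs P₂ P₁ h₂ (by linarith))
      (pi_exists_lt_dist_sq_le (n := n) μ hw hw1 hσ hd u)))))))))))
  by_contra hcon
  simp only [Set.mem_union, Set.mem_ofPred_eq, not_or, not_not, not_exists, not_lt] at hcon
  exact hp ⟨hcon.1, hcon.2.1, hcon.2.2.1, hcon.2.2.2.1, hcon.2.2.2.2.1, hcon.2.2.2.2.2⟩

end Gaussian

/-! ### The parameters -/

/-- The relations between the parameters of the algorithm for large `n` and `d`. -/
theorem parameter_bounds {k n d : ℕ} {δ ε ω : ℝ} (hk : 0 < k) (hω0 : 0 < ω) (hδ0 : 0 < δ)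
    (hδ1 : δ < 1) (hε0 : 0 < ε) (hε1 : ε < 1)
    (hn : (16000 + 13 * (1 + Real.log (32 * k))) / ω ≤ Real.log n) (hd : 16000 / ω ≤ d)
    (hε : Real.log (Real.log (n / δ)) / Real.log n ≤ ε) :
    0 < dK δ ε k ∧ 0 < eta δ ε k n ∧ k ≤ kPlus δ ε k ∧
    (kPlus δ ε k : ℝ) ≤ ω * (eta δ ε k n / 2) / 16 ∧
    (truncNum δ ε k : ℝ) ≤ ω * (eta δ ε k n / 2) / 64 ∧ 0 < Real.log (n / δ) ∧
    512 * (18 + 8 * (1 + Real.log (n / δ) / d)) * (3 * k * dK δ ε k / 2) ≤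
      ω * (eta δ ε k n / 2) ∧
    16 * k * Real.exp (-(ω * eta δ ε k n / 40)) ≤ δ / 2 := by
  have hk1 : (1 : ℝ) ≤ k := by exact_mod_cast hk
  have hlk : 0 ≤ Real.log (32 * k) := Real.log_nonneg (by linarith)
  have hlog : 0 < Real.log n := lt_of_lt_of_le (by positivity) hn
  have hn0 : (0 : ℝ) < n := by
    rcases Nat.eq_zero_or_pos n with rfl | h
    · simp at hlog
    · exact_mod_cast h
  have hlδ : Real.log δ < 0 := Real.log_neg hδ0 hδ1
  have hu : Real.log n ≤ Real.log (n / δ) := by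
    rw [Real.log_div hn0.ne' hδ0.ne']
    linarith
  have hu0 : 0 < Real.log (n / δ) := hlog.trans_le hu
  set R := (n : ℝ) ^ ε with hR
  -- This is the only use of the lower bound on `ε`: it says `log (n/δ) ≤ n ^ ε`.
  have hER : Real.log (n / δ) ≤ R := by
    rw [div_le_iff₀ hlog] at hε
    rw [hR, Real.rpow_def_of_pos hn0, ← Real.exp_log hu0]
    exact Real.exp_le_exp.2 (by linarith)
  have hωR : 16000 + 13 * (1 + Real.log (32 * k)) ≤ ω * R := by
    rw [div_le_iff₀ hω0] at hn
    nlinarith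
  set L := Real.log (1.1 * k / (δ * ε)) with hL
  have hL1 : Real.log 1.1 - Real.log δ ≤ L := by
    rw [← Real.log_div (by norm_num) hδ0.ne']
    refine Real.log_le_log (by positivity) ?_
    rw [div_le_div_iff₀ hδ0 (by positivity)]
    nlinarith [mul_pos hδ0 hε0]
  -- The factor 1.1 keeps `L` away from zero even for `k = 1` and `δ`, `ε` close to 1, since `log
  -- 1.1 ≥ 1 - 1/1.1 = 1/11`.
  have h11 : 1 / 11 ≤ Real.log 1.1 := by
    have := Real.one_sub_inv_le_log_of_pos (x := 1.1) (by norm_num)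
    norm_num at this ⊢
    linarith
  have hL0 : 1 / 11 ≤ L := by linarith
  have hkL : (k : ℝ) ≤ 11 * (k * L) := by nlinarith
  have hLkL : L ≤ k * L := by nlinarith
  have hkL0 : 0 < k * L := by nlinarith
  have hη : eta δ ε k n = 36 * (k * L) * R := by
    rw [eta]
    ring
  have hdK : dK δ ε k = 6.5 * L := rfl
  have hωη : k * L * 16000 ≤ k * L * (ω * R) :=
    mul_le_mul_of_nonneg_left (by linarith) hkL0.le
  refine ⟨by rw [hdK]; linarith, ?_, ?_, ?_, ?_, hu0, ?_, ?_⟩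
  · rw [hη]
    have : 0 < R := hu0.trans_le hER
    positivity
  · exact Nat.le_floor (by linarith)
  · refine (Nat.floor_le (by linarith)).trans ?_
    rw [hη]
    nlinarith
  · refine (Nat.floor_le (by rw [hdK]; positivity)).trans ?_
    rw [hη, hdK]
    nlinarith
  · rw [hη, hdK]
    have hdω : 16000 ≤ d * ω := by rwa [div_le_iff₀ hω0] at hd
    have hd0 : (0 : ℝ) < d := lt_of_lt_of_le (by positivity) hd
    have h1 : Real.log (n / δ) / d ≤ ω * R / 16000 := by
      rw [div_le_div_iff₀ hd0 (by norm_num)]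
      calc Real.log (n / δ) * 16000 ≤ R * (d * ω) :=
            mul_le_mul hER hdω (by norm_num) (hu0.le.trans hER)
        _ = ω * R * d := by ring
    -- Here `9.75 = (3/2) * 6.5` comes from `d_k` and `18 = 36 / 2` from `η / 2`; the common factor
    -- `k * L` is split off.
    have h2 : 512 * (18 + 8 * (1 + Real.log (n / δ) / d)) * 9.75 ≤ 18 * (ω * R) := by linarith
    have h3 := mul_le_mul_of_nonneg_right h2 hkL0.le
    calc _ = 512 * (18 + 8 * (1 + Real.log (n / δ) / d)) * 9.75 * (k * L) := by ring
      _ ≤ 18 * (ω * R) * (k * L) := h3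
      _ = _ := by ring
  -- The left side of `h1` is `log (32k/δ)`. Since `L ≥ 1/11 - log δ`, it suffices that `(36/40) *
  -- (ω * R) / 11` exceeds `log (32k)`, which is why 13 multiplies that logarithm in the bound on
  -- `n`.
  · have h1 : Real.log (32 * k) - Real.log δ ≤ ω * eta δ ε k n / 40 := by
      rw [hη]
      have h2 : 1 * L ≤ k * L := by linarith
      have h3 : L * (ω * R) ≤ k * L * (ω * R) :=
        mul_le_mul_of_nonneg_right hLkL (by linarith)
      have h4 : (1 / 11 - Real.log δ) * (ω * R) ≤ L * (ω * R) :=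
        mul_le_mul_of_nonneg_right (by linarith) (by linarith)
      nlinarith
    calc 16 * k * Real.exp (-(ω * eta δ ε k n / 40)) ≤
          16 * k * Real.exp (-(Real.log (32 * k) - Real.log δ)) := by gcongr
      _ = δ / 2 := by
          rw [neg_sub, Real.exp_sub, Real.exp_log hδ0, Real.exp_log (by positivity)]
          field_simp
          norm_num

theorem exists_pos_le_weights {k : ℕ} {w : Fin k → ℝ} (hw : ∀ i, 0 < w i) :
    ∃ ω : ℝ, 0 < ω ∧ ω ≤ 1 ∧ ∀ i, ω ≤ w i := by
  induction k with
  | zero => exact ⟨1, one_pos, le_rfl, fun i => i.elim0⟩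
  | succ k ih =>
    obtain ⟨ω, h0, h1, h⟩ := ih (w := fun i => w i.succ) fun i => hw _
    refine ⟨min ω (w 0), lt_min h0 (hw 0), (min_le_left _ _).trans h1, fun i => ?_⟩
    refine Fin.cases (min_le_right _ _) (fun j => ?_) i
    exact (min_le_left _ _).trans (h j)

end Soccer

end

/-! ### The theorem -/

theorem theorem2 (β : ℝ) (hβ : 1 ≤ β) :
    -- the approximation factor depends on `β` only
    ∃ C : ℝ, 0 < C ∧
      ∀ (k : ℕ) (w : Fin k → ℝ), (∀ i, 0 < w i) → ∑ i, w i = 1 →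
      -- how large `d` must be may depend on the number `k₊` of centers, but not on `n`
      ∃ (n₀ : ℕ) (d₀ : ℕ → ℕ),
      ∀ (δ ε : ℝ), 0 < δ → δ < 1 → 0 < ε → ε < 1 →
      ∀ (n d : ℕ), n₀ ≤ n → d₀ (Soccer.kPlus δ ε k) ≤ d →
      Real.log (Real.log (n / δ)) / Real.log n ≤ ε →
      ∀ (μ : Fin k → EuclideanSpace ℝ (Fin d)) (σ : Fin k → ℝ), (∀ i, 0 < σ i) →
      ∀ (m : ℕ) (machine : (Fin n → EuclideanSpace ℝ (Fin d)) → Fin n → Fin m)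
        (A : Multiset (EuclideanSpace ℝ (Fin d)) → ℕ → Finset (EuclideanSpace ℝ (Fin d))),
      Soccer.IsApproxAlgorithm β A →
      -- the (outer) probability of the complement of the claimed event is at most `δ`
      Soccer.jointLaw (Soccer.sphericalMixture w μ σ) n
        {p | ¬ ∃ r : ℕ, r ≤ 1 ∧ (Soccer.eta δ ε k n < n → r = 1) ∧
          (Soccer.Input.mk p.1 (machine p.1) δ ε k A).StopsAfter p.2 r ∧
          Soccer.cost (Finset.univ.val.map p.1)
              ((Soccer.Input.mk p.1 (machine p.1) δ ε k A).output p.2 r) ≤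
            ENNReal.ofReal C * Soccer.optCost (Finset.univ.val.map p.1) k}
        ≤ ENNReal.ofReal δ := by
  refine ⟨299008 * β, by linarith, fun k w hw hw1 => ?_⟩
  obtain ⟨ω, hω0, hω1, hω⟩ := Soccer.exists_pos_le_weights hw
  have hk : 0 < k := by
    rcases Nat.eq_zero_or_pos k with rfl | h
    · simp at hw1
    · exact h
  have hk1 : (1 : ℝ) ≤ k := by exact_mod_cast hk
  -- The `+ 2` ensures `n ≥ 2`, used for `δ² / n ≤ δ / 2`. In `d₀`, the term `16000 / ω` makes `log
  -- (n/δ) / d` small against `ω * n ^ ε`, and `6 * log (q + 1)` makes `q` balls of probability `exp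
  -- (-d/6)` negligible.
  refine ⟨⌈Real.exp ((16000 + 13 * (1 + Real.log (32 * k))) / ω)⌉₊ + 2,
    fun q => ⌈16000 / ω + 6 * Real.log (q + 1)⌉₊, ?_⟩
  intro δ ε hδ0 hδ1 hε0 hε1 n d hn hd hε μ σ hσ m machine A hA
  have hn2 : (2 : ℝ) ≤ n := by exact_mod_cast (Nat.le_add_left 2 _).trans hn
  have hlogn : (16000 + 13 * (1 + Real.log (32 * k))) / ω ≤ Real.log n := by
    rw [Real.le_log_iff_exp_le (by linarith)]
    refine (Nat.le_ceil _).trans ?_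
    exact_mod_cast (Nat.le_add_right _ 2).trans hn
  set q := Soccer.kPlus δ ε k with hq
  have hdR : 16000 / ω + 6 * Real.log (q + 1) ≤ d := (Nat.le_ceil _).trans (by exact_mod_cast hd)
  have hlq : 0 ≤ Real.log ((q : ℝ) + 1) := Real.log_nonneg (by
    linarith [Nat.cast_nonneg (α := ℝ) q])
  have hdω : 16000 / ω ≤ d := by linarith
  have hd0 : 0 < d := by
    have : (0 : ℝ) < d := lt_of_lt_of_le (by positivity) hdω
    exact_mod_cast this
  have hqd : q * Real.exp (-(d / 6 : ℝ)) ≤ Real.exp (-(64 / ω)) := by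
    have h1 : -(d / 6 : ℝ) ≤ -(64 / ω) - Real.log (q + 1) := by
      have : 16000 / ω = 250 * (64 / ω) := by ring
      have : 0 < 64 / ω := by positivity
      linarith
    calc q * Real.exp (-(d / 6 : ℝ)) ≤
          (q + 1) * Real.exp (-(64 / ω) - Real.log (q + 1)) := by
          gcongr
          linarith
      _ = Real.exp (-(64 / ω)) := by
          rw [Real.exp_sub, Real.exp_log (by positivity)]
          field_simp
  obtain ⟨hdK, hη0, hkq, hqη, hlη, hu, hg, hexp⟩ :=
    Soccer.parameter_bounds hk hω0 hδ0 hδ1 hε0 hε1 hlogn hdω hε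
  set η := Soccer.eta δ ε k n with hη
  set u := Real.log (n / δ) with hu_def
  by_cases hηn : η < n
  swap
  · refine (measure_mono_null (t := ∅) ?_ measure_empty).trans_le zero_le
    intro p hp
    refine hp ⟨0, zero_le_one, fun h => absurd h hηn, ?_, ?_⟩
    · exact Soccer.Input.stopsAfter_zero _ _ (not_lt.1 hηn)
    · refine (Soccer.Input.cost_output_zero_le _ hA p.2).trans ?_
      exact mul_le_mul_left (ENNReal.ofReal_le_ofReal (by linarith)) _
  have := Soccer.isProbabilityMeasure_labelledMixture
    (N := fun i => Soccer.sphericalGaussian (μ i) (σ i)) hw hw1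
  have : IsProbabilityMeasure (Soccer.sphericalMixture w μ σ) := by
    have h := Soccer.map_snd_labelledMixture (w := w)
      (N := fun i => Soccer.sphericalGaussian (μ i) (σ i))
    change IsProbabilityMeasure
      (∑ i, ENNReal.ofReal (w i) • Soccer.sphericalGaussian (μ i) (σ i))
    rw [← h]
    exact Measure.isProbabilityMeasure_map measurable_snd.aemeasurable
  set Q : Soccer.Coins n → Finset (Fin n) × Finset (Fin n) := fun c =>
    (Soccer.Input.firstSample (η / n) c 0, Soccer.Input.firstSample (η / n) c 1) with hQ
  set G : Finset (Fin n) × Finset (Fin n) → Prop := fun f =>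
    (η / 2 ≤ f.1.card ∧ (f.1.card : ℝ) ≤ 3 * η) ∧ (η / 2 ≤ f.2.card ∧ (f.2.card : ℝ) ≤ 3 * η)
    with hG
  -- Data are bad for given sub-samples if no labelling at all makes them good. The algorithm and
  -- the partition do not occur in `B`.
  set B : Finset (Fin n) × Finset (Fin n) → Set (Fin n → EuclideanSpace ℝ (Fin d)) := fun f =>
    {x | ∀ lab : Fin n → Fin k, (fun j => (lab j, x j)) ∈ {p | ¬ Soccer.IsGoodSample w μ
      (fun i => σ i * √d) q (8 * (1 + u / d)) f.1 f.2 p}} with hB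
  have hQm : ∀ f, MeasurableSet {c | Q c = f} := by
    rintro ⟨f₁, f₂⟩
    simp only [hQ, Prod.mk.injEq]
    exact (Soccer.measurableSet_firstSample_eq _ 0 f₁).inter
      (Soccer.measurableSet_firstSample_eq _ 1 f₂)
  have hprod := Soccer.prod_le_of_forall_value
    (Measure.pi fun _ : Fin n => Soccer.sphericalMixture w μ σ) (Soccer.coinLaw n) hQm G B
    (fun f hf => (Soccer.pi_forall_label_le
      (Soccer.measurableSet_isGoodSample w μ _ q _ f.1 f.2).compl).trans
      (Soccer.pi_not_isGoodSample_le μ hw hw1 hσ hd0 u hω0 hω hω1 hqd hηn.le hf.1.1 hf.1.2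
        hf.2.1))
  have hsize : ∀ l, ((Measure.pi fun _ : Fin n => Soccer.sphericalMixture w μ σ).prod
      (Soccer.coinLaw n)) (Set.univ ×ˢ {c | ¬ (η / 2 ≤ (Soccer.Input.firstSample (η / n) c l).card ∧
        ((Soccer.Input.firstSample (η / n) c l).card : ℝ) ≤ 3 * η)}) ≤
      ENNReal.ofReal (2 * Real.exp (-(η / 10))) := fun l => by
    rw [Measure.prod_prod, measure_univ, one_mul]
    exact Soccer.coinLaw_card_firstSample hη0.le hηn l
  have htotal : ENNReal.ofReal (2 * Real.exp (-(η / 10))) +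
      (ENNReal.ofReal (2 * Real.exp (-(η / 10))) + ENNReal.ofReal
        (11 * k * Real.exp (-(ω * η / 40)) + n * Real.exp (-(2 * u)))) ≤ ENNReal.ofReal δ := by
    rw [← ENNReal.ofReal_add (by positivity) (by positivity),
      ← ENNReal.ofReal_add (by positivity) (by positivity)]
    refine ENNReal.ofReal_le_ofReal ?_
    have h1 : Real.exp (-(η / 10)) ≤ k * Real.exp (-(ω * η / 40)) := by
      refine le_trans (Real.exp_le_exp.2 ?_) (le_mul_of_one_le_left (Real.exp_nonneg _) hk1)
      nlinarith
    -- With `u = log (n/δ)` the union bound for outliers is `n * (δ/n)² = δ² / n`.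
    have h2 : n * Real.exp (-(2 * u)) ≤ δ / 2 := by
      have h3 : Real.exp (-(2 * u)) = (δ / n) ^ 2 := by
        rw [show -(2 * u) = (2 : ℕ) * -u by push_cast; ring, Real.exp_nat_mul, hu_def,
          ← Real.log_inv, Real.exp_log (by positivity), inv_div]
      have h4 : n * (δ / n) ^ 2 = δ * δ / n := by
        field_simp
      rw [h3, h4, div_le_div_iff₀ (by linarith) two_pos]
      nlinarith
    have h3 : 0 ≤ k * Real.exp (-(ω * η / 40)) := by positivity
    linarith
  -- Failure needs a sub-sample of wrong size or data bad for well-sized sub-samples. Outside these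
  -- events the deterministic result applies with some good labelling.
  refine (measure_mono ?_).trans (((measure_union_le _ _).trans (add_le_add (hsize 0)
    ((measure_union_le _ _).trans (add_le_add (hsize 1) hprod)))).trans htotal)
  rintro ⟨x, c⟩ hp
  by_contra hcon
  simp only [Set.mem_union, Set.mem_prod, Set.mem_univ, true_and, Set.mem_ofPred_eq, not_or,
    not_not] at hcon
  obtain ⟨h₁, h₂, h₃⟩ := hcon
  have hGQ : G (Q c) := ⟨h₁, h₂⟩
  simp only [hGQ, true_and, hB, Set.mem_ofPred_eq, not_forall, not_not] at h₃
  obtain ⟨lab, hgood⟩ := h₃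
  have hηn' : ω * (η / 2) ≤ ω * n := mul_le_mul_of_nonneg_left (by linarith) hω0.le
  have hωP : ∀ i, ω * (η / 2) ≤ w i * (Q c).2.card := fun i =>
    mul_le_mul (hω i) h₂.1 (by linarith) (hw i).le
  have hωn : ∀ i, ω * (η / 2) ≤ w i * n := fun i =>
    mul_le_mul (hω i) (by linarith) (by linarith) (hw i).le
  obtain ⟨hrun, hcost⟩ := Soccer.Input.stopsAfter_one_of_isTypical
    (Soccer.Input.mk x (machine x) δ ε k A) hβ hA c hη0.le hηn hk hkq hdK hw
    (r := fun i => σ i * √d) (fun i => mul_pos (hσ i) (by positivity)) (μ := μ) (lab := lab)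
    (P₁ := (Q c).1) (P₂ := (Q c).2) (b := 8 * (1 + u / d)) (by positivity) rfl rfl
    (by
      have : (0 : ℝ) < (Q c).1.card := lt_of_lt_of_le (by linarith) h₁.1
      exact_mod_cast this)
    hgood.typical hgood.typical_fst hgood.typical_snd hgood.separated hgood.separated_snd
    hgood.dist_sq_le (fun i => by linarith [hωn i]) (fun i => by linarith [hωP i])
    (fun i => by linarith [hωP i]) (fun i => hg.trans (hωP i))
  exact hp ⟨1, le_rfl, fun _ => rfl, hrun, hcost⟩
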